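/- Let $|x|=\sqrt{x_1^2+x_2^2}$ for $x\in\mathbb Z^2$, let $\Delta u(x)=\sum_{y\in\mathbb Z^2,\,|y-x|=1}(u(y)-u(x))$ be the discrete Laplacian, and let $\delta_0$ be the indicator function of $\{0\}$. Let $\kappa>0$, $\alpha_0=\frac{4\pi}{\kappa}$, $\beta>\alpha_0$, and $\gamma_0=\frac1\pi\big(\gamma_E+\frac12\ln 2\big)$ with $\gamma_E$ the Euler constant. Consider the equation $$-\Delta u+e^{\kappa u}=\beta\delta_0\quad\text{in }\mathbb Z^2.\tag{1}$$ There is a family $(u_\alpha)_{\alpha\in[\alpha_0,\beta)}$ of solutions $u_\alpha:\mathbb Z^2\to\mathbb R$ of (1) with the following properties. (i) For every $\alpha\in(\alpha_0,\beta)$ there is $d_{\kappa,\alpha,\beta}\in\mathbb R$ such that $$u_\alpha(x)=-\frac{\alpha}{2\pi}\ln|x|+d_{\kappa,\alpha,\beta}+O\Big(|x|^{\frac{4\pi-\alpha\kappa}{\alpha\kappa+2\pi}}(\ln|x|)^{\frac{2\pi}{\alpha\kappa+2\pi}}\Big)\quad\text{as }x\to\infty,$$ and $d_{\kappa,\alpha,\beta}\le\frac1\kappa\ln(\beta-\alpha)-\frac{\gamma_0}{2}\alpha$.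 (ii) $u_{\alpha_0}(x)=-\frac2\kappa\ln|x|-\frac2\kappa\ln\ln|x|+O(1)$ as $x\to\infty$. (iii) The family is strictly decreasing, i.e. $u_{\alpha_1}(x)>u_{\alpha_2}(x)$ for all $x\in\mathbb Z^2$ and $\alpha_0\le\alpha_1<\alpha_2<\beta$. It is pointwise continuous: $\lim_{\alpha\to\tilde\alpha}u_\alpha(x)=u_{\tilde\alpha}(x)$ for all $x\in\mathbb Z^2$ and $\tilde\alpha\in(\alpha_0,\beta)$, and $\lim_{\alpha\to\alpha_0^+}u_\alpha(x)=u_{\alpha_0}(x)$ for all $x\in\mathbb Z^2$. Moreover, $\sum_{x\in\mathbb Z^2}e^{\kappa u_\alpha(x)}=\beta-\alpha$ for every $\alpha\in[\alpha_0,\beta)$. -/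

import Mathlib

open Filter Asymptotics Topology

namespace LatticeLiouville

/-- The Euclidean length `|x|` of a point of the lattice `ℤ²`. -/
noncomputable def len (x : ℤ × ℤ) : ℝ :=
  Real.sqrt ((x.1 : ℝ) ^ 2 + (x.2 : ℝ) ^ 2)

/-- The neighbours of a point of the lattice graph `ℤ²`. -/
def neighbours (x : ℤ × ℤ) : Finset (ℤ × ℤ) :=
  {(x.1 + 1, x.2), (x.1 - 1, x.2), (x.1, x.2 + 1), (x.1, x.2 - 1)}

/-- The neighbours of `x` are exactly the lattice points at Euclidean distance one from `x`. -/
theorem mem_neighbours_iff (x y : ℤ × ℤ) : y ∈ neighbours x ↔ len (x - y) = 1 := by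
  obtain ⟨a, b⟩ := x
  obtain ⟨c, d⟩ := y
  have h : len ((a, b) - (c, d)) = 1 ↔ (a - c) ^ 2 + (b - d) ^ 2 = 1 := by
    unfold len
    rw [Real.sqrt_eq_one]
    simp only [Prod.mk_sub_mk]
    exact_mod_cast Iff.rfl
  rw [h]
  simp only [neighbours, Finset.mem_insert, Finset.mem_singleton, Prod.mk.injEq]
  constructor
  · rintro (⟨rfl, rfl⟩ | ⟨rfl, rfl⟩ | ⟨rfl, rfl⟩ | ⟨rfl, rfl⟩) <;> ring
  · intro h
    have h1 : a - c ≤ 1 := by nlinarith [sq_nonneg (b - d)]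
    have h2 : -1 ≤ a - c := by nlinarith [sq_nonneg (b - d)]
    have h3 : b - d ≤ 1 := by nlinarith [sq_nonneg (a - c)]
    have h4 : -1 ≤ b - d := by nlinarith [sq_nonneg (a - c)]
    generalize hp : a - c = p at *
    generalize hq : b - d = q at *
    interval_cases p <;> interval_cases q <;> simp at h <;> omega

/-- The discrete Laplacian `Δu(x) = ∑_{y ∼ x} (u(y) - u(x))` on `ℤ²`. -/
def laplacian (u : ℤ × ℤ → ℝ) (x : ℤ × ℤ) : ℝ :=
  ∑ y ∈ neighbours x, (u y - u x)

/-- The indicator function of the origin. -/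
def delta (x : ℤ × ℤ) : ℝ := if x = 0 then 1 else 0

/-- `u` solves `-Δu + e^{κu} = β δ₀` in `ℤ²`. -/
def IsSolution (κ β : ℝ) (u : ℤ × ℤ → ℝ) : Prop :=
  ∀ x, -laplacian u x + Real.exp (κ * u x) = β * delta x

/-- The constant `γ₀ = (γ_E + (ln 2) / 2) / π`, with `γ_E` the Euler constant. -/
noncomputable def gammaZero : ℝ :=
  1 / Real.pi * (Real.eulerMascheroniConstant + 1 / 2 * Real.log 2)

end LatticeLiouville

namespace LatticeLiouville

/-! ### The discrete Laplacian and the maximum principle -/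

/-! Subtract the expected logarithm. Let `a` be the potential kernel, `Δa = δ₀` and `a 0 = 0`.
Writing `u = w - α a` turns the equation into `-Δw + g e^{κw} = (β - α) δ₀` with `g = e^{-κ α a}`.
Since `a` grows like `ln|x| / (2π)`, the weight `g` is summable when `ακ > 4π`, and the new equation
is the Euler–Lagrange equation of a coercive functional (`exists_weighted_solution`). Varying the
minimiser by constants gives the mass identity, and truncating it at height `w 0` shows that `w ≤ w
0`.

The density `g e^{κw} - (β - α) δ₀` has total mass zero, so its logarithmic potential decays at a
power rate. It differs from `w` by a harmonic function bounded above, which is constant by Liouville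
(`weighted_solution_expansion`). This yields the expansion in (i). The bound on the constant term
follows from `c ≤ w 0`, the inequality `e^{κ w 0} ≤ β - α`, and the expansion of `a` in
`exists_abs_potential_sub_log_le`. That expansion rests on a one-dimensional integral for `a`, its
exact values on the diagonal, and `Δ ln|x|² = O(|x|⁻⁴)`.

Solutions with different slopes are ordered by the maximum principle. Monotonicity together with the
mass identity gives continuity in `α`, because the differences of `e^{κu}` are nonnegative and sum
to the difference of the parameters. At `α₀` the solution is the increasing limit as `α` decreases
to `α₀`. Barriers of the form `-p ln|x|² - 2 ln ln|x|² + C`, with constants uniform in `α`, pass to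
the limit and give (ii). -/

theorem laplacian_eq (u : ℤ × ℤ → ℝ) (x : ℤ × ℤ) :
    laplacian u x =
      u (x + (1, 0)) + u (x - (1, 0)) + u (x + (0, 1)) + u (x - (0, 1)) - 4 * u x := by
  obtain ⟨a, b⟩ := x
  unfold laplacian neighbours
  rw [Finset.sum_insert, Finset.sum_insert, Finset.sum_insert, Finset.sum_singleton]
  · simp
    ring
  · simp; omega
  · simp
  · simp; omega

theorem laplacian_sub (u v : ℤ × ℤ → ℝ) (x : ℤ × ℤ) :
    laplacian (fun y => u y - v y) x = laplacian u x - laplacian v x := by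
  simp only [laplacian_eq]; ring

theorem laplacian_add (u v : ℤ × ℤ → ℝ) (x : ℤ × ℤ) :
    laplacian (fun y => u y + v y) x = laplacian u x + laplacian v x := by
  simp only [laplacian_eq]; ring

theorem laplacian_const_mul (c : ℝ) (u : ℤ × ℤ → ℝ) (x : ℤ × ℤ) :
    laplacian (fun y => c * u y) x = c * laplacian u x := by
  simp only [laplacian_eq]; ring

theorem laplacian_const (c : ℝ) (x : ℤ × ℤ) : laplacian (fun _ => c) x = 0 := by
  simp only [laplacian_eq]; ring

theorem laplacian_translate (u : ℤ × ℤ → ℝ) (h x : ℤ × ℤ) :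
    laplacian (fun y => u (y + h)) x = laplacian u (x + h) := by
  simp only [laplacian_eq]
  have h1 : ∀ e, x + e + h = x + h + e := fun e => add_right_comm x e h
  have h2 : ∀ e, x - e + h = x + h - e := fun e => (add_sub_right_comm x h e).symm
  simp only [h1, h2]

theorem exists_isMax_of_eventually_lt {z : ℤ × ℤ → ℝ} {c : ℝ} {x₁ : ℤ × ℤ}
    (hlt : ∀ᶠ x in cofinite, z x < c) (hx₁ : c ≤ z x₁) : ∃ x₀, c ≤ z x₀ ∧ ∀ x, z x ≤ z x₀ := by
  have hfin : {x | c ≤ z x}.Finite := by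
    simpa [Filter.eventually_cofinite] using hlt
  obtain ⟨x₀, hx₀, hmax⟩ := hfin.exists_maximalFor z _ ⟨x₁, hx₁⟩
  refine ⟨x₀, hx₀, fun x => ?_⟩
  by_contra! h
  exact absurd (hmax (show c ≤ z x from le_trans hx₀ h.le) h.le) (not_le.mpr h)

/-- The maximum principle on the whole lattice. -/
theorem lt_of_laplacian_nonneg {z : ℤ × ℤ → ℝ} {c : ℝ} (hlt : ∀ᶠ x in cofinite, z x < c)
    (hsub : ∀ x, c ≤ z x → 0 ≤ laplacian z x) (x : ℤ × ℤ) : z x < c := by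
  by_contra! hx
  obtain ⟨x₀, hx₀, hmax⟩ := exists_isMax_of_eventually_lt hlt hx
  -- At a maximum, a nonnegative Laplacian forces every neighbour to take the same value. Moving
  -- right repeatedly gives an infinite ray inside a finite superlevel set.
  have hline : ∀ n : ℕ, z (x₀ + ((n : ℤ), 0)) = z x₀ := by
    intro n
    induction n with
    | zero => simp [show ((0 : ℤ), (0 : ℤ)) = 0 from rfl]
    | succ n ih =>
      have h1 := hsub (x₀ + ((n : ℤ), 0)) (ih ▸ hx₀)
      rw [laplacian_eq, ih] at h1
      have h2 := hmax (x₀ + ((n : ℤ), 0) - (1, 0))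
      have h3 := hmax (x₀ + ((n : ℤ), 0) + (0, 1))
      have h4 := hmax (x₀ + ((n : ℤ), 0) - (0, 1))
      have h5 := hmax (x₀ + ((n : ℤ), 0) + (1, 0))
      have h6 : x₀ + (((n + 1 : ℕ) : ℤ), 0) = x₀ + ((n : ℤ), 0) + (1, 0) := by
        rw [add_assoc]; simp
      rw [h6]
      linarith
  have hfin : {x | c ≤ z x}.Finite := by
    simpa [Filter.eventually_cofinite] using hlt
  refine Set.infinite_of_injective_forall_mem (f := fun n : ℕ => x₀ + ((n : ℤ), (0 : ℤ))) ?_ ?_ hfin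
  · intro m n h
    simpa using h
  · intro n
    simp only [Set.mem_ofPred_eq, hline n, hx₀]

theorem eq_zero_of_harmonic_of_tendsto {z : ℤ × ℤ → ℝ} (hz : ∀ x, laplacian z x = 0)
    (h0 : Tendsto z cofinite (𝓝 0)) (x : ℤ × ℤ) : z x = 0 := by
  have key : ∀ w : ℤ × ℤ → ℝ, (∀ x, laplacian w x = 0) → Tendsto w cofinite (𝓝 0) →
      w x ≤ 0 := by
    intro w hw hw0
    refine le_of_forall_pos_le_add fun ε hε => ?_
    rw [zero_add]
    exact (lt_of_laplacian_nonneg (hw0.eventually (gt_mem_nhds hε)) (fun y _ => (hw y).ge) x).le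
  have h1 := key z hz h0
  have h2 := key (fun y => -1 * z y) (fun y => by rw [laplacian_const_mul, hz, mul_zero])
    (by simpa using h0.const_mul (-1))
  linarith

/-- A function on the lattice with vanishing first differences is constant. -/
theorem eq_of_differences_eq_zero {u : ℤ × ℤ → ℝ} (h1 : ∀ x, u (x + (1, 0)) - u x = 0)
    (h2 : ∀ x, u (x + (0, 1)) - u x = 0) (x : ℤ × ℤ) : u x = u 0 := by
  have hx : ∀ m n : ℤ, u (m, n) = u (0, n) := by
    intro m n
    induction m using Int.induction_on with
    | zero => rfl
    | succ k ih => rw [← ih]; simpa [sub_eq_zero] using h1 (k, n)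
    | pred k ih =>
      rw [← ih]
      have := h1 (-k - 1, n)
      simp [sub_eq_zero] at this
      exact this.symm
  have hy : ∀ n : ℤ, u (0, n) = u (0, 0) := by
    intro n
    induction n using Int.induction_on with
    | zero => rfl
    | succ k ih => rw [← ih]; simpa [sub_eq_zero] using h2 (0, k)
    | pred k ih =>
      rw [← ih]
      have := h2 (0, -k - 1)
      simp [sub_eq_zero] at this
      exact this.symm
  obtain ⟨m, n⟩ := x
  rw [hx, hy]; rfl

/-- First differences of a harmonic function are again harmonic, so the maximum principle makes them
vanish. -/
theorem eq_of_harmonic_of_tendsto_differences {u : ℤ × ℤ → ℝ} (hu : ∀ x, laplacian u x = 0)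
    (h1 : Tendsto (fun x => u (x + (1, 0)) - u x) cofinite (𝓝 0))
    (h2 : Tendsto (fun x => u (x + (0, 1)) - u x) cofinite (𝓝 0)) (x : ℤ × ℤ) : u x = u 0 := by
  refine eq_of_differences_eq_zero (fun y => ?_) (fun y => ?_) x
  · exact eq_zero_of_harmonic_of_tendsto (z := fun y => u (y + (1, 0)) - u y)
      (fun y => by rw [laplacian_sub, laplacian_translate, hu, hu, sub_zero]) h1 y
  · exact eq_zero_of_harmonic_of_tendsto (z := fun y => u (y + (0, 1)) - u y)
      (fun y => by rw [laplacian_sub, laplacian_translate, hu, hu, sub_zero]) h2 y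

/-- Liouville's theorem for harmonic functions bounded above, given a function tending to infinity
that is harmonic off the origin. -/
theorem eq_of_harmonic_of_le {a u : ℤ × ℤ → ℝ} (ha : Tendsto a cofinite atTop)
    (ha0 : a 0 = 0) (hla : ∀ x, x ≠ 0 → laplacian a x = 0) (hu : ∀ x, laplacian u x = 0) {M : ℝ}
    (hM : ∀ x, u x ≤ M) (x : ℤ × ℤ) : u x = u 0 := by
  have key : ∀ v : ℤ × ℤ → ℝ, (∀ x, laplacian v x = 0) → (∀ x, v x ≤ M) → ∀ x, v x ≤ v 0 := by
    intro v hv hvM x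
    -- The term `-ε a` forces decay at infinity. Its Laplacian is negative only at the origin, where
    -- the function is `0 < ε`, so the origin never enters the test of the maximum principle.
    have hε : ∀ ε > 0, v x - v 0 - ε * a x < ε := by
      intro ε hε
      refine lt_of_laplacian_nonneg (z := fun y => v y - v 0 - ε * a y) ?_ ?_ x
      · filter_upwards [ha.eventually_gt_atTop ((M - v 0) / ε)] with y hy
        have := hvM y
        rw [div_lt_iff₀ hε] at hy
        linarith
      · intro y hy
        have hy0 : y ≠ 0 := by
          rintro rfl
          simp only [ha0] at hy
          linarith
        rw [laplacian_sub, laplacian_sub, laplacian_const_mul, hv, laplacian_const, hla y hy0]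
        simp
    have hlim : Tendsto (fun ε : ℝ => ε + ε * a x) (𝓝[>] 0) (𝓝 0) := by
      have : Tendsto (fun ε : ℝ => ε + ε * a x) (𝓝 0) (𝓝 (0 + 0 * a x)) :=
        Continuous.tendsto (by fun_prop) 0
      simp only [zero_mul, add_zero] at this
      exact this.mono_left nhdsWithin_le_nhds
    have : v x - v 0 ≤ 0 := by
      refine ge_of_tendsto hlim ?_
      filter_upwards [self_mem_nhdsWithin] with ε hε'
      have := hε ε hε'
      linarith
    linarith
  refine le_antisymm (key u hu hM x) ?_
  -- Translation by `x` exchanges the roles of `x` and `0`.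
  have := key (fun y => u (y + x)) (fun y => by rw [laplacian_translate, hu]) (fun y => hM _) (-x)
  simpa using this

/-! ### Norms and summability -/

theorem norm_int_prod (x : ℤ × ℤ) : ‖x‖ = max |(x.1 : ℝ)| |(x.2 : ℝ)| := by
  rw [Prod.norm_def, Int.norm_eq_abs, Int.norm_eq_abs]

theorem tendsto_norm_cofinite : Tendsto (fun x : ℤ × ℤ => ‖x‖) cofinite atTop := by
  rw [← Filter.cocompact_eq_cofinite]
  exact tendsto_norm_cocompact_atTop

theorem one_le_norm {x : ℤ × ℤ} (hx : x ≠ 0) : 1 ≤ ‖x‖ := by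
  rw [norm_int_prod, le_max_iff]
  by_contra! h
  apply hx
  have h1 : |x.1| < 1 := by exact_mod_cast h.1
  have h2 : |x.2| < 1 := by exact_mod_cast h.2
  rw [Int.abs_lt_one_iff] at h1 h2
  exact Prod.ext h1 h2

theorem norm_le_len (x : ℤ × ℤ) : ‖x‖ ≤ len x := by
  rw [norm_int_prod, len]
  refine max_le ?_ ?_ <;> apply Real.abs_le_sqrt <;> nlinarith [sq_nonneg (x.1 : ℝ), sq_nonneg (x.2 : ℝ)]

theorem len_le_two_mul_norm (x : ℤ × ℤ) : len x ≤ 2 * ‖x‖ := by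
  have h1 : |(x.1 : ℝ)| ≤ ‖x‖ := by rw [norm_int_prod]; exact le_max_left _ _
  have h2 : |(x.2 : ℝ)| ≤ ‖x‖ := by rw [norm_int_prod]; exact le_max_right _ _
  rw [len, Real.sqrt_le_left (by positivity)]
  have h3 := sq_le_sq' (by linarith [abs_nonneg (x.1 : ℝ), norm_nonneg x]) h1
  have h4 := sq_le_sq' (by linarith [abs_nonneg (x.2 : ℝ), norm_nonneg x]) h2
  rw [sq_abs] at h3 h4
  nlinarith [norm_nonneg x]

theorem summable_one_add_norm_rpow {q : ℝ} (hq : 2 < q) :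
    Summable (fun x : ℤ × ℤ => (1 + ‖x‖) ^ (-q)) := by
  have h := EisensteinSeries.summable_one_div_norm_rpow hq
  rw [← (finTwoArrowEquiv ℤ).symm.summable_iff] at h
  have hnorm : ∀ x : ℤ × ℤ, ‖(finTwoArrowEquiv ℤ).symm x‖ = ‖x‖ := by
    intro x
    apply le_antisymm
    · rw [pi_norm_le_iff_of_nonneg (norm_nonneg _)]
      intro i
      fin_cases i
      · exact norm_fst_le x
      · exact norm_snd_le x
    · refine max_le ?_ ?_
      · exact norm_le_pi_norm ((finTwoArrowEquiv ℤ).symm x) 0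
      · exact norm_le_pi_norm ((finTwoArrowEquiv ℤ).symm x) 1
  refine h.of_norm_bounded_eventually ?_
  filter_upwards [(Set.finite_singleton (0 : ℤ × ℤ)).compl_mem_cofinite] with x hx
  have hx1 := one_le_norm hx
  rw [Function.comp_apply, hnorm, Real.norm_of_nonneg (by positivity)]
  exact Real.rpow_le_rpow_of_nonpos (by linarith) (by linarith) (by linarith)

/-! ### The potential kernel of the lattice as a one-dimensional integral -/

/-- The decay factor `cos t / (1 + sin t) = tan (π/4 - t/2)`. -/
noncomputable def decay (t : ℝ) : ℝ := Real.cos t / (1 + Real.sin t)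

/-- `∫₀^{π/2} (1 - cos (ξ t) q(t)ⁿ) / sin t dt`, with `q` the decay factor. -/
noncomputable def diagonalKernel (ξ : ℤ) (n : ℕ) : ℝ :=
  ∫ t in (0 : ℝ)..(Real.pi / 2), (1 - Real.cos (ξ * t) * decay t ^ n) / Real.sin t

/-- The potential kernel of the lattice: `Δ a = δ₀` and `a 0 = 0`. -/
noncomputable def potential (x : ℤ × ℤ) : ℝ :=
  1 / (2 * Real.pi) * diagonalKernel (x.1 + x.2) (x.1 - x.2).natAbs

theorem sin_nonneg_of_mem {t : ℝ} (ht : t ∈ Set.Icc 0 (Real.pi / 2)) : 0 ≤ Real.sin t :=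
  Real.sin_nonneg_of_nonneg_of_le_pi ht.1 (by linarith [ht.2, Real.pi_pos])

theorem cos_nonneg_of_mem {t : ℝ} (ht : t ∈ Set.Icc 0 (Real.pi / 2)) : 0 ≤ Real.cos t :=
  Real.cos_nonneg_of_neg_pi_div_two_le_of_le (by linarith [ht.1, Real.pi_pos]) ht.2

theorem uIcc_zero_half_pi : Set.uIcc 0 (Real.pi / 2) = Set.Icc 0 (Real.pi / 2) :=
  Set.uIcc_of_le (by positivity)

theorem decay_nonneg {t : ℝ} (ht : t ∈ Set.Icc 0 (Real.pi / 2)) : 0 ≤ decay t :=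
  div_nonneg (cos_nonneg_of_mem ht) (by linarith [sin_nonneg_of_mem ht])

theorem decay_mul_one_add_sin {t : ℝ} (ht : t ∈ Set.Icc 0 (Real.pi / 2)) :
    decay t * (1 + Real.sin t) = Real.cos t :=
  div_mul_cancel₀ _ (by linarith [sin_nonneg_of_mem ht])

theorem decay_mul_cos {t : ℝ} (ht : t ∈ Set.Icc 0 (Real.pi / 2)) :
    decay t * Real.cos t = 1 - Real.sin t := by
  have := sin_nonneg_of_mem ht
  rw [decay, div_mul_eq_mul_div, div_eq_iff (by linarith)]
  nlinarith [Real.sin_sq_add_cos_sq t]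

theorem hasDerivAt_decay {t : ℝ} (ht : t ∈ Set.Icc 0 (Real.pi / 2)) :
    HasDerivAt decay (-(1 / (1 + Real.sin t))) t := by
  have h0 : 1 + Real.sin t ≠ 0 := by linarith [sin_nonneg_of_mem ht]
  have h := (Real.hasDerivAt_cos t).div ((Real.hasDerivAt_sin t).const_add 1) h0
  refine h.congr_deriv ?_
  field_simp
  nlinarith [Real.sin_sq_add_cos_sq t]

theorem decay_zero : decay 0 = 1 := by simp [decay]

theorem continuousOn_decay : ContinuousOn decay (Set.Icc 0 (Real.pi / 2)) :=
  fun _ ht => (hasDerivAt_decay ht).continuousAt.continuousWithinAt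

theorem intervalIntegrable_of_continuousOn_Icc {f : ℝ → ℝ}
    (hf : ContinuousOn f (Set.Icc 0 (Real.pi / 2))) :
    IntervalIntegrable f MeasureTheory.volume 0 (Real.pi / 2) :=
  ContinuousOn.intervalIntegrable (by rwa [uIcc_zero_half_pi])

/-- By `decay_mul_cos` the singular factor `1 / sin t` cancels: a unit step changes the integrand by
a continuous function. Both integrability and all difference estimates use this. -/
theorem kernel_integrand_step (ξ : ℤ) (n : ℕ) {t : ℝ} (ht : t ∈ Set.Icc 0 (Real.pi / 2))
    (hs : Real.sin t ≠ 0) :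
    (1 - Real.cos ((ξ + 1 : ℤ) * t) * decay t ^ (n + 1)) / Real.sin t =
      (1 - Real.cos (ξ * t) * decay t ^ n) / Real.sin t +
        (decay t ^ n * Real.cos (ξ * t) + decay t ^ (n + 1) * Real.sin (ξ * t)) := by
  have h := decay_mul_cos ht
  have h1 : ((ξ + 1 : ℤ) : ℝ) * t = ξ * t + t := by push_cast; ring
  rw [h1, Real.cos_add]
  field_simp
  rw [pow_succ]
  linear_combination (-(decay t ^ n * Real.cos (ξ * t))) * h

theorem sin_pos_of_mem_uIoc {t : ℝ} (ht : t ∈ Set.uIoc 0 (Real.pi / 2)) :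
    t ∈ Set.Icc 0 (Real.pi / 2) ∧ Real.sin t ≠ 0 := by
  rw [Set.uIoc_of_le (by positivity)] at ht
  exact ⟨⟨ht.1.le, ht.2⟩,
    (Real.sin_pos_of_pos_of_lt_pi ht.1 (by linarith [ht.2, Real.pi_pos])).ne'⟩

/-- For `n = 0` the quadratic bound on `1 - cos` and Jordan's inequality for `sin` make the
integrand bounded. Each further step adds a continuous term. -/
theorem intervalIntegrable_kernel (ξ : ℤ) (n : ℕ) :
    IntervalIntegrable (fun t => (1 - Real.cos (ξ * t) * decay t ^ n) / Real.sin t)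
      MeasureTheory.volume 0 (Real.pi / 2) := by
  induction n generalizing ξ with
  | zero =>
    have hc : IntervalIntegrable (fun _ : ℝ => (ξ : ℝ) ^ 2 * (Real.pi ^ 2 / 8))
      MeasureTheory.volume 0 (Real.pi / 2) := by simp
    refine hc.mono_fun ?_ ?_
    · have : Measurable fun t : ℝ => (1 - Real.cos (ξ * t) * decay t ^ 0) / Real.sin t := by
        simp only [pow_zero, mul_one]
        fun_prop
      exact this.aestronglyMeasurable
    · refine (MeasureTheory.ae_restrict_iff' measurableSet_uIoc).mpr
        (Filter.Eventually.of_forall fun t ht => ?_)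
      rw [Set.uIoc_of_le (by positivity)] at ht
      have hs := Real.mul_le_sin ht.1.le ht.2
      have h1 := Real.one_sub_sq_div_two_le_cos (x := ξ * t)
      have h2 := Real.cos_le_one (ξ * t)
      have hpos : 0 < 2 / Real.pi * t := by have := ht.1; positivity
      simp only [pow_zero, mul_one]
      rw [norm_div, Real.norm_of_nonneg (by linarith), Real.norm_of_nonneg (by linarith),
        Real.norm_of_nonneg (by positivity), div_le_iff₀ (by linarith)]
      calc 1 - Real.cos (ξ * t) ≤ (ξ * t) ^ 2 / 2 := by linarith
        _ = (ξ : ℝ) ^ 2 * t * (t / 2) := by ring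
        _ ≤ (ξ : ℝ) ^ 2 * t * (Real.pi / 2 / 2) := by
            have := ht.1
            have := ht.2
            gcongr
        _ = (ξ : ℝ) ^ 2 * (Real.pi ^ 2 / 8) * (2 / Real.pi * t) := by
            field_simp; ring
        _ ≤ _ := by gcongr
  | succ n ih =>
    have h := (ih (ξ - 1)).add (intervalIntegrable_of_continuousOn_Icc
      (f := fun t => decay t ^ n * Real.cos ((ξ - 1 : ℤ) * t) +
        decay t ^ (n + 1) * Real.sin ((ξ - 1 : ℤ) * t)) (by
        have := continuousOn_decay; fun_prop))
    refine h.congr ?_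
    intro t ht
    obtain ⟨h1, h2⟩ := sin_pos_of_mem_uIoc ht
    have := kernel_integrand_step (ξ - 1) n h1 h2
    rw [sub_add_cancel] at this
    exact this.symm

theorem intervalIntegrable_decay_mul (n : ℕ) {f : ℝ → ℝ} (hf : Continuous f) :
    IntervalIntegrable (fun t => decay t ^ n * f t) MeasureTheory.volume 0 (Real.pi / 2) :=
  intervalIntegrable_of_continuousOn_Icc (by have := continuousOn_decay; fun_prop)

theorem diagonalKernel_step (ξ : ℤ) (n : ℕ) :
    diagonalKernel (ξ + 1) (n + 1) - diagonalKernel ξ n =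
      (∫ t in (0 : ℝ)..(Real.pi / 2), decay t ^ n * Real.cos (ξ * t)) +
        ∫ t in (0 : ℝ)..(Real.pi / 2), decay t ^ (n + 1) * Real.sin (ξ * t) := by
  rw [diagonalKernel, diagonalKernel, ← intervalIntegral.integral_add
    (intervalIntegrable_decay_mul n (by fun_prop))
    (intervalIntegrable_decay_mul (n + 1) (by fun_prop)),
    ← intervalIntegral.integral_sub (intervalIntegrable_kernel _ _) (intervalIntegrable_kernel _ _)]
  refine intervalIntegral.integral_congr_ae (Filter.Eventually.of_forall fun t ht => ?_)
  obtain ⟨h1, h2⟩ := sin_pos_of_mem_uIoc ht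
  rw [kernel_integrand_step ξ n h1 h2]
  ring

theorem diagonalKernel_neg (ξ : ℤ) (n : ℕ) : diagonalKernel (-ξ) n = diagonalKernel ξ n := by
  simp [diagonalKernel, Real.cos_neg]

theorem diagonalKernel_step_neg (ξ : ℤ) (n : ℕ) :
    diagonalKernel (ξ - 1) (n + 1) - diagonalKernel ξ n =
      (∫ t in (0 : ℝ)..(Real.pi / 2), decay t ^ n * Real.cos (ξ * t)) -
        ∫ t in (0 : ℝ)..(Real.pi / 2), decay t ^ (n + 1) * Real.sin (ξ * t) := by
  have h := diagonalKernel_step (-ξ) n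
  rw [show -ξ + 1 = -(ξ - 1) by ring, diagonalKernel_neg, diagonalKernel_neg] at h
  rw [h]
  simp [Real.cos_neg, Real.sin_neg, sub_eq_add_neg]

theorem diagonalKernel_zero_zero : diagonalKernel 0 0 = 0 := by simp [diagonalKernel]

/-- In the rotated coordinates `ξ = x₁ + x₂`, `n = |x₁ - x₂|` a lattice step changes each coordinate
by one. Harmonicity off `n = 0` reflects that the decay factor `q` solves `q² cos t - 2q + cos t =
0`. -/
theorem diagonalKernel_harmonic (ξ : ℤ) (n : ℕ) :
    diagonalKernel (ξ + 1) (n + 2) + diagonalKernel (ξ - 1) (n + 2) + diagonalKernel (ξ + 1) n +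
      diagonalKernel (ξ - 1) n - 4 * diagonalKernel ξ (n + 1) = 0 := by
  have h1 := diagonalKernel_step ξ (n + 1)
  have h2 := diagonalKernel_step_neg ξ (n + 1)
  have h3 := diagonalKernel_step (ξ - 1) n
  have h4 := diagonalKernel_step_neg (ξ + 1) n
  rw [sub_add_cancel] at h3
  rw [add_sub_cancel_right] at h4
  have h5 : (∫ t in (0 : ℝ)..(Real.pi / 2), decay t ^ n * Real.cos ((ξ - 1 : ℤ) * t)) +
      (∫ t in (0 : ℝ)..(Real.pi / 2), decay t ^ (n + 1) * Real.sin ((ξ - 1 : ℤ) * t)) +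
      ((∫ t in (0 : ℝ)..(Real.pi / 2), decay t ^ n * Real.cos ((ξ + 1 : ℤ) * t)) -
        ∫ t in (0 : ℝ)..(Real.pi / 2), decay t ^ (n + 1) * Real.sin ((ξ + 1 : ℤ) * t)) =
      2 * ∫ t in (0 : ℝ)..(Real.pi / 2), decay t ^ (n + 1) * Real.cos (ξ * t) := by
    have hint : ∀ m : ℕ, ∀ k : ℤ, IntervalIntegrable (fun t => decay t ^ m * Real.cos (k * t))
        MeasureTheory.volume 0 (Real.pi / 2) :=
      fun m k => intervalIntegrable_decay_mul m (by fun_prop)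
    have hint' : ∀ m : ℕ, ∀ k : ℤ, IntervalIntegrable (fun t => decay t ^ m * Real.sin (k * t))
        MeasureTheory.volume 0 (Real.pi / 2) :=
      fun m k => intervalIntegrable_decay_mul m (by fun_prop)
    rw [← intervalIntegral.integral_add (hint _ _) (hint' _ _),
      ← intervalIntegral.integral_sub (hint _ _) (hint' _ _),
      ← intervalIntegral.integral_add ((hint _ _).add (hint' _ _)) ((hint _ _).sub (hint' _ _)),
      ← intervalIntegral.integral_const_mul]
    refine intervalIntegral.integral_congr fun t ht => ?_
    rw [uIcc_zero_half_pi] at ht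
    have h := decay_mul_one_add_sin ht
    have e1 : ((ξ - 1 : ℤ) : ℝ) * t = ξ * t - t := by push_cast; ring
    have e2 : ((ξ + 1 : ℤ) : ℝ) * t = ξ * t + t := by push_cast; ring
    simp only [e1, e2, Real.cos_add, Real.cos_sub, Real.sin_add, Real.sin_sub, pow_succ]
    linear_combination (-2 * decay t ^ n * Real.cos (ξ * t)) * h
  linarith

theorem integral_cos_even (k : ℤ) :
    ∫ t in (0 : ℝ)..(Real.pi / 2), Real.cos ((2 * k : ℤ) * t) =
      if k = 0 then Real.pi / 2 else 0 := by
  split_ifs with hk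
  · subst hk; simp
  · have hk' : ((2 * k : ℤ) : ℝ) ≠ 0 := by exact_mod_cast (by omega : 2 * k ≠ 0)
    rw [intervalIntegral.integral_comp_mul_left (fun t => Real.cos t) hk', integral_cos]
    have : ((2 * k : ℤ) : ℝ) * (Real.pi / 2) = k * Real.pi := by push_cast; ring
    rw [this, Real.sin_int_mul_pi]
    simp

theorem potential_zero : potential 0 = 0 := by
  simp [potential, diagonalKernel_zero_zero]

/-- Off the diagonal this is `diagonalKernel_harmonic`. On it, all four neighbours have `n = 1`; the
sine integrals cancel and `∫ cos (2at)` over a quarter period remains, which is nonzero only at the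
origin. -/
theorem laplacian_potential (x : ℤ × ℤ) : laplacian potential x = delta x := by
  obtain ⟨a, b⟩ := x
  have e1 : a + 1 + b = a + b + 1 := by ring
  have e2 : a - 1 + b = a + b - 1 := by ring
  have e3 : a + (b + 1) = a + b + 1 := by ring
  have e4 : a + (b - 1) = a + b - 1 := by ring
  rw [laplacian_eq]
  simp only [potential, Prod.mk_add_mk, Prod.mk_sub_mk, add_zero, sub_zero, e1, e2, e3, e4]
  rcases lt_trichotomy (a - b) 0 with h | h | h
  · obtain ⟨n, hn⟩ : ∃ n : ℕ, (a - b).natAbs = n + 1 := ⟨(a - b).natAbs - 1, by omega⟩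
    rw [show (a + 1 - b).natAbs = n by omega, show (a - 1 - b).natAbs = n + 2 by omega,
      show (a - (b + 1)).natAbs = n + 2 by omega, show (a - (b - 1)).natAbs = n by omega, hn]
    have := diagonalKernel_harmonic (a + b) n
    have hd : delta (a, b) = 0 := by
      rw [delta, if_neg]
      intro h0
      rw [Prod.ext_iff] at h0
      simp at h0
      omega
    rw [hd]
    linear_combination (1 / (2 * Real.pi)) * this
  · obtain rfl : a = b := by omega
    rw [show (a + 1 - a).natAbs = 1 by omega, show (a - 1 - a).natAbs = 1 by omega,
      show (a - (a + 1)).natAbs = 1 by omega, show (a - (a - 1)).natAbs = 1 by omega,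
      show (a - a).natAbs = 0 by omega]
    have h1 := diagonalKernel_step (a + a) 0
    have h2 := diagonalKernel_step_neg (a + a) 0
    simp only [pow_zero, one_mul, ← two_mul, zero_add, integral_cos_even] at h1 h2
    have hd : delta (a, a) = if a = 0 then 1 else 0 := by simp [delta, Prod.ext_iff]
    rw [hd, ← two_mul]
    have hpi := Real.pi_pos.ne'
    split_ifs at h1 h2 ⊢
    · have h3 : diagonalKernel (2 * a + 1) 1 + diagonalKernel (2 * a - 1) 1 -
          2 * diagonalKernel (2 * a) 0 = Real.pi := by linarith
      field_simp
      linarith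
    · have h3 : diagonalKernel (2 * a + 1) 1 + diagonalKernel (2 * a - 1) 1 -
          2 * diagonalKernel (2 * a) 0 = 0 := by linarith
      linear_combination (1 / Real.pi) * h3
  · obtain ⟨n, hn⟩ : ∃ n : ℕ, (a - b).natAbs = n + 1 := ⟨(a - b).natAbs - 1, by omega⟩
    rw [show (a + 1 - b).natAbs = n + 2 by omega, show (a - 1 - b).natAbs = n by omega,
      show (a - (b + 1)).natAbs = n by omega, show (a - (b - 1)).natAbs = n + 2 by omega, hn]
    have := diagonalKernel_harmonic (a + b) n
    have hd : delta (a, b) = 0 := by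
      rw [delta, if_neg]
      intro h0
      rw [Prod.ext_iff] at h0
      simp at h0
      omega
    rw [hd]
    linear_combination (1 / (2 * Real.pi)) * this

/-- Going from `(n, n)` to the next diagonal point through an off-diagonal neighbour, the cosine
integrals cancel and `2 ∫ sin ((2n+1)t)` remains. These exact values later fix the constants in the
expansion of the kernel. -/
theorem potential_diagonal (n : ℕ) :
    potential (n, n) = 1 / Real.pi * ∑ k ∈ Finset.range n, 1 / (2 * (k : ℝ) + 1) := by
  induction n with
  | zero => simpa [show ((0 : ℤ), (0 : ℤ)) = 0 from rfl] using potential_zero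
  | succ n ih =>
    have h1 := diagonalKernel_step_neg (2 * n + 2) 0
    have h2 := diagonalKernel_step (2 * n) 0
    have h3 : (2 * n + 2 - 1 : ℤ) = 2 * n + 1 := by ring
    have e1 : (2 * n + 2 : ℤ) = 2 * ((n : ℤ) + 1) := by ring
    rw [h3, e1] at h1
    simp only [pow_zero, one_mul, zero_add, pow_one] at h1 h2
    have hn : ((n : ℤ) + 1) ≠ 0 := by omega
    rw [integral_cos_even, if_neg hn] at h1
    rw [integral_cos_even] at h2
    have hint : ∀ k : ℤ, IntervalIntegrable (fun t => decay t * Real.sin (k * t))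
        MeasureTheory.volume 0 (Real.pi / 2) := by
      intro k
      simpa using intervalIntegrable_decay_mul 1 (f := fun t => Real.sin (k * t)) (by fun_prop)
    have h4 : (∫ t in (0 : ℝ)..(Real.pi / 2), decay t * Real.sin ((2 * n : ℤ) * t)) +
        (∫ t in (0 : ℝ)..(Real.pi / 2), decay t * Real.sin ((2 * ((n : ℤ) + 1) : ℤ) * t)) =
        ∫ t in (0 : ℝ)..(Real.pi / 2),
          (2 * Real.sin ((2 * n + 1 : ℤ) * t) - (Real.cos ((2 * n : ℤ) * t) -
            Real.cos ((2 * ((n : ℤ) + 1) : ℤ) * t))) := by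
      rw [← intervalIntegral.integral_add (hint _) (hint _)]
      refine intervalIntegral.integral_congr fun t ht => ?_
      rw [uIcc_zero_half_pi] at ht
      have h := decay_mul_cos ht
      have e1 : ((2 * n : ℤ) : ℝ) * t = (2 * n + 1 : ℤ) * t - t := by push_cast; ring
      have e2 : ((2 * ((n : ℤ) + 1) : ℤ) : ℝ) * t = (2 * n + 1 : ℤ) * t + t := by push_cast; ring
      simp only [e1, e2, Real.cos_add, Real.cos_sub, Real.sin_add, Real.sin_sub]
      linear_combination (2 * Real.sin (((2 * n + 1 : ℤ) : ℝ) * t)) * h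
    have h5 : ∫ t in (0 : ℝ)..(Real.pi / 2), Real.sin ((2 * n + 1 : ℤ) * t) =
        1 / (2 * (n : ℝ) + 1) := by
      have hk : ((2 * n + 1 : ℤ) : ℝ) ≠ 0 := by exact_mod_cast (by omega : (2 * n + 1 : ℤ) ≠ 0)
      rw [intervalIntegral.integral_comp_mul_left (fun t => Real.sin t) hk, integral_sin]
      have : ((2 * n + 1 : ℤ) : ℝ) * (Real.pi / 2) = n * Real.pi + Real.pi / 2 := by
        push_cast; ring
      rw [this, Real.cos_add_pi_div_two, Real.sin_nat_mul_pi]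
      simp
    rw [intervalIntegral.integral_sub, intervalIntegral.integral_const_mul, h5,
      intervalIntegral.integral_sub, integral_cos_even, integral_cos_even, if_neg hn] at h4
    · rw [Finset.sum_range_succ, mul_add, ← ih]
      simp only [potential, sub_self, Int.natAbs_zero]
      rw [show (((n + 1 : ℕ) : ℤ) + ((n + 1 : ℕ) : ℤ)) = 2 * ((n : ℤ) + 1) by push_cast; ring,
        ← two_mul]
      have h6 : diagonalKernel (2 * ((n : ℤ) + 1)) 0 - diagonalKernel (2 * n) 0 =
        2 * (1 / (2 * (n : ℝ) + 1)) := by linarith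
      have hpi := Real.pi_pos.ne'
      rw [← sub_eq_iff_eq_add', ← mul_sub, h6]
      field_simp
    all_goals exact Continuous.intervalIntegrable (by fun_prop) _ _

/-! ### Decay of the differences of the potential kernel -/

/-- `decay ^ (n+1)` has derivative `-(n+1) decay ^ n / (1 + sin t)`, and `1 + sin t ≤ 2`. -/
theorem integral_decay_pow_le (n : ℕ) :
    ∫ t in (0 : ℝ)..(Real.pi / 2), decay t ^ n ≤ 2 / (n + 1) := by
  have hd : ∀ t ∈ Set.uIcc 0 (Real.pi / 2), HasDerivAt (fun t => -(2 / ((n : ℝ) + 1)) * decay t ^ (n + 1))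
      (2 * decay t ^ n / (1 + Real.sin t)) t := by
    intro t ht
    rw [uIcc_zero_half_pi] at ht
    have := sin_nonneg_of_mem ht
    refine (((hasDerivAt_decay ht).pow (n + 1)).const_mul _).congr_deriv ?_
    have h1 : (n : ℝ) + 1 ≠ 0 := by positivity
    have h2 : 1 + Real.sin t ≠ 0 := by positivity
    push_cast
    field_simp
  have hc : ContinuousOn (fun t => 2 * decay t ^ n / (1 + Real.sin t))
      (Set.Icc 0 (Real.pi / 2)) := by
    have := continuousOn_decay
    refine ContinuousOn.div (by fun_prop) (by fun_prop) fun t ht => ?_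
    have := sin_nonneg_of_mem ht
    positivity
  have hi := intervalIntegral.integral_eq_sub_of_hasDerivAt hd
    (intervalIntegrable_of_continuousOn_Icc hc)
  calc ∫ t in (0 : ℝ)..(Real.pi / 2), decay t ^ n
      ≤ ∫ t in (0 : ℝ)..(Real.pi / 2), 2 * decay t ^ n / (1 + Real.sin t) := by
        refine intervalIntegral.integral_mono_on (by positivity)
          (intervalIntegrable_of_continuousOn_Icc (by have := continuousOn_decay; fun_prop))
          (intervalIntegrable_of_continuousOn_Icc hc) fun t ht => ?_
        have h1 := sin_nonneg_of_mem ht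
        have h2 := pow_nonneg (decay_nonneg ht) n
        rw [le_div_iff₀ (by positivity)]
        nlinarith [Real.sin_le_one t]
    _ ≤ 2 / (n + 1) := by
        rw [hi]
        have : decay (Real.pi / 2) = 0 := by simp [decay]
        simp [this, decay_zero]

theorem abs_integral_decay_pow_mul_le (n : ℕ) {f : ℝ → ℝ} (hf : Continuous f)
    (h1 : ∀ t, |f t| ≤ 1) :
    |∫ t in (0 : ℝ)..(Real.pi / 2), decay t ^ n * f t| ≤ 2 / (n + 1) := by
  refine (intervalIntegral.abs_integral_le_integral_abs (by positivity)).trans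
    (le_trans ?_ (integral_decay_pow_le n))
  refine intervalIntegral.integral_mono_on (by positivity)
    (intervalIntegrable_decay_mul n hf).abs
    (intervalIntegrable_of_continuousOn_Icc (by have := continuousOn_decay; fun_prop))
    fun t ht => ?_
  have h2 := pow_nonneg (decay_nonneg ht) n
  rw [abs_mul, abs_of_nonneg h2]
  exact mul_le_of_le_one_right h2 (h1 t)

/-- Integration by parts: `decay ^ n` decreases from `1`, so its boundary values and total variation
add up to at most `2`. -/
theorem abs_integral_decay_pow_mul_deriv_le (n : ℕ) {v v' : ℝ → ℝ} {B : ℝ}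
    (hv : ∀ t, HasDerivAt v (v' t) t) (hv' : Continuous v') (hB : ∀ t, |v t| ≤ B) :
    |∫ t in (0 : ℝ)..(Real.pi / 2), decay t ^ n * v' t| ≤ 2 * B := by
  have hB0 : 0 ≤ B := (abs_nonneg _).trans (hB 0)
  set d : ℝ → ℝ := fun t => n * decay t ^ (n - 1) * -(1 / (1 + Real.sin t)) with hd_def
  have hd : ∀ t ∈ Set.uIcc 0 (Real.pi / 2), HasDerivAt (fun t => decay t ^ n) (d t) t := by
    intro t ht
    rw [uIcc_zero_half_pi] at ht
    exact (hasDerivAt_decay ht).pow n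
  have hc : ContinuousOn d (Set.Icc 0 (Real.pi / 2)) := by
    have := continuousOn_decay
    refine ContinuousOn.mul (by fun_prop) (ContinuousOn.neg (ContinuousOn.div (by fun_prop)
      (by fun_prop) fun t ht => ?_))
    have := sin_nonneg_of_mem ht
    positivity
  have hdi := intervalIntegrable_of_continuousOn_Icc hc
  have hvc : Continuous v := continuous_iff_continuousAt.mpr fun t => (hv t).continuousAt
  have hdn : ∀ t ∈ Set.Icc 0 (Real.pi / 2), d t ≤ 0 := by
    intro t ht
    have h1 := sin_nonneg_of_mem ht
    have h2 := pow_nonneg (decay_nonneg ht) (n - 1)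
    have : 0 ≤ n * decay t ^ (n - 1) * (1 / (1 + Real.sin t)) := by positivity
    simp only [hd_def]
    linarith
  have hparts := intervalIntegral.integral_mul_deriv_eq_deriv_mul hd (fun t _ => hv t) hdi
    (hv'.intervalIntegrable _ _)
  have hftc := intervalIntegral.integral_eq_sub_of_hasDerivAt hd hdi
  have hrem : |∫ t in (0 : ℝ)..(Real.pi / 2), d t * v t| ≤
      -(decay (Real.pi / 2) ^ n - decay 0 ^ n) * B := by
    rw [← hftc, ← intervalIntegral.integral_neg, ← intervalIntegral.integral_mul_const]
    refine (intervalIntegral.abs_integral_le_integral_abs (by positivity)).trans ?_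
    refine intervalIntegral.integral_mono_on (by positivity)
      (intervalIntegrable_of_continuousOn_Icc (hc.mul hvc.continuousOn)).abs
      (hdi.neg.mul_const B) fun t ht => ?_
    rw [abs_mul, abs_of_nonpos (hdn t ht)]
    exact mul_le_mul_of_nonneg_left (hB t) (by linarith [hdn t ht])
  rw [hparts]
  have h1 : 0 ≤ decay (Real.pi / 2) ^ n :=
    pow_nonneg (decay_nonneg ⟨by positivity, le_rfl⟩) n
  have h2 : |decay (Real.pi / 2) ^ n * v (Real.pi / 2)| ≤ decay (Real.pi / 2) ^ n * B := by
    rw [abs_mul, abs_of_nonneg h1]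
    exact mul_le_mul_of_nonneg_left (hB _) h1
  have h3 := hB 0
  rw [decay_zero, one_pow] at hrem ⊢
  rw [abs_le] at *
  constructor <;> linarith [h2.1, h2.2, h3.1, h3.2, hrem.1, hrem.2]

/-- If `n` dominates, the decay of `decay ^ n` suffices; if `|ξ|` dominates, oscillation gains a
factor `1/|ξ|` through integration by parts. -/
theorem abs_integral_decay_pow_mul_cos_le (n : ℕ) (ξ : ℤ) :
    |∫ t in (0 : ℝ)..(Real.pi / 2), decay t ^ n * Real.cos (ξ * t)| ≤
      4 / (1 + max |(ξ : ℝ)| n) := by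
  rcases le_total |(ξ : ℝ)| n with h | h
  · rw [max_eq_right h]
    refine (abs_integral_decay_pow_mul_le n (by fun_prop) fun t => Real.abs_cos_le_one _).trans ?_
    rw [add_comm]
    gcongr
    norm_num
  · rw [max_eq_left h]
    by_cases hξ : ξ = 0
    · subst hξ
      have hn : n = 0 := by simpa using h
      subst hn
      refine (abs_integral_decay_pow_mul_le 0 (by fun_prop) fun t =>
        Real.abs_cos_le_one _).trans ?_
      norm_num
    · have hξ' : (ξ : ℝ) ≠ 0 := by exact_mod_cast hξ
      have h1 : 1 ≤ |(ξ : ℝ)| := by exact_mod_cast Int.one_le_abs hξ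
      refine (abs_integral_decay_pow_mul_deriv_le n (v := fun t => Real.sin (ξ * t) / ξ)
        (B := 1 / |(ξ : ℝ)|) (fun t => ?_) (by fun_prop) fun t => ?_).trans ?_
      · refine ((((hasDerivAt_id t).const_mul (ξ : ℝ)).sin).div_const _).congr_deriv ?_
        simp only [id]
        field_simp
      · rw [abs_div]
        gcongr
        exact Real.abs_sin_le_one _
      · rw [mul_one_div, div_le_div_iff₀ (by positivity) (by positivity)]
        linarith

theorem abs_integral_decay_pow_mul_sin_le (n : ℕ) (ξ : ℤ) :
    |∫ t in (0 : ℝ)..(Real.pi / 2), decay t ^ (n + 1) * Real.sin (ξ * t)| ≤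
      4 / (1 + max |(ξ : ℝ)| n) := by
  rcases le_total |(ξ : ℝ)| n with h | h
  · rw [max_eq_right h]
    refine (abs_integral_decay_pow_mul_le (n + 1) (by fun_prop)
      fun t => Real.abs_sin_le_one _).trans ?_
    push_cast
    rw [div_le_div_iff₀ (by positivity) (by positivity)]
    linarith [(Nat.cast_nonneg n : (0 : ℝ) ≤ n)]
  · rw [max_eq_left h]
    by_cases hξ : ξ = 0
    · subst hξ
      simp
    · have hξ' : (ξ : ℝ) ≠ 0 := by exact_mod_cast hξ
      have h1 : 1 ≤ |(ξ : ℝ)| := by exact_mod_cast Int.one_le_abs hξ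
      refine (abs_integral_decay_pow_mul_deriv_le (n + 1) (v := fun t => -Real.cos (ξ * t) / ξ)
        (B := 1 / |(ξ : ℝ)|) (fun t => ?_) (by fun_prop) fun t => ?_).trans ?_
      · refine ((((hasDerivAt_id t).const_mul (ξ : ℝ)).cos.neg).div_const _).congr_deriv ?_
        simp only [id]
        field_simp
      · rw [abs_div, abs_neg]
        gcongr
        exact Real.abs_cos_le_one _
      · rw [mul_one_div, div_le_div_iff₀ (by positivity) (by positivity)]
        linarith

theorem abs_diagonalKernel_up_le (ξ ξ' : ℤ) (n : ℕ) (h : ξ' = ξ + 1 ∨ ξ' = ξ - 1) :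
    |diagonalKernel ξ' (n + 1) - diagonalKernel ξ n| ≤ 8 / (1 + max |(ξ : ℝ)| n) := by
  have h1 := abs_le.mp (abs_integral_decay_pow_mul_cos_le n ξ)
  have h2 := abs_le.mp (abs_integral_decay_pow_mul_sin_le n ξ)
  have e : 8 / (1 + max |(ξ : ℝ)| n) = 2 * (4 / (1 + max |(ξ : ℝ)| n)) := by ring
  rw [abs_le, e]
  rcases h with rfl | rfl
  · rw [diagonalKernel_step]
    constructor <;> linarith [h1.1, h1.2, h2.1, h2.2]
  · rw [diagonalKernel_step_neg]
    constructor <;> linarith [h1.1, h1.2, h2.1, h2.2]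

theorem abs_diagonalKernel_sub_le (ξ ξ' : ℤ) (n n' : ℕ) (h : ξ' = ξ + 1 ∨ ξ' = ξ - 1)
    (hn : n' = n + 1 ∨ n = n' + 1) :
    |diagonalKernel ξ' n' - diagonalKernel ξ n| ≤ 16 / (1 + max |(ξ : ℝ)| n) := by
  rcases hn with rfl | rfl
  · refine (abs_diagonalKernel_up_le ξ ξ' n h).trans ?_
    gcongr
    norm_num
  -- The estimate is centred at the neighbour; recentring it changes the denominator by at most a
  -- factor two, hence `16` instead of `8`.
  · rw [abs_sub_comm]
    refine (abs_diagonalKernel_up_le ξ' ξ n' (by omega)).trans ?_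
    rw [div_le_div_iff₀ (by positivity) (by positivity)]
    have h1 : |(ξ : ℝ)| ≤ |(ξ' : ℝ)| + 1 := by
      have : |ξ| ≤ |ξ'| + 1 := by rcases abs_cases ξ with h1 | h1 <;> rcases abs_cases ξ' with h2 | h2 <;> omega
      exact_mod_cast this
    have h2 : max |(ξ : ℝ)| ((n' + 1 : ℕ) : ℝ) ≤ max |(ξ' : ℝ)| n' + 1 := by
      push_cast
      refine max_le (h1.trans ?_) ?_ <;> gcongr
      · exact le_max_left _ _
      · exact le_max_right _ _
    have h3 : 0 ≤ max |(ξ' : ℝ)| n' := le_max_of_le_left (abs_nonneg _)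
    linarith

theorem norm_le_max_diagonal (x : ℤ × ℤ) :
    ‖x‖ ≤ max |((x.1 + x.2 : ℤ) : ℝ)| ((x.1 - x.2).natAbs : ℝ) := by
  rw [norm_int_prod, Nat.cast_natAbs, Int.cast_abs]
  push_cast
  have h1 := le_max_left |(x.1 + x.2 : ℝ)| |(x.1 - x.2 : ℝ)|
  have h2 := le_max_right |(x.1 + x.2 : ℝ)| |(x.1 - x.2 : ℝ)|
  have h3 := abs_add_le (x.1 + x.2 : ℝ) (x.1 - x.2)
  have h4 := abs_sub (x.1 + x.2 : ℝ) (x.1 - x.2)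
  rw [show (x.1 + x.2 + (x.1 - x.2) : ℝ) = 2 * x.1 by ring, abs_mul, abs_two] at h3
  rw [show (x.1 + x.2 - (x.1 - x.2) : ℝ) = 2 * x.2 by ring, abs_mul, abs_two] at h4
  exact max_le (by linarith) (by linarith)

/-- Each coordinate difference of the potential kernel is `O(1/|x|)`. -/
theorem abs_potential_diff_le (x e : ℤ × ℤ) (he : e = (1, 0) ∨ e = (0, 1)) :
    |potential (x + e) - potential x| ≤ 3 / (1 + ‖x‖) := by
  have key : |diagonalKernel ((x + e).1 + (x + e).2) ((x + e).1 - (x + e).2).natAbs -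
      diagonalKernel (x.1 + x.2) (x.1 - x.2).natAbs| ≤
      16 / (1 + max |((x.1 + x.2 : ℤ) : ℝ)| ((x.1 - x.2).natAbs : ℝ)) := by
    apply abs_diagonalKernel_sub_le <;> rcases he with rfl | rfl <;> simp <;> omega
  have hx := norm_le_max_diagonal x
  have hn := norm_nonneg x
  rw [potential, potential, ← mul_sub, abs_mul, abs_of_pos (by positivity)]
  have hpi := Real.pi_gt_three
  calc _ ≤ 1 / (2 * 3) * (16 / (1 + ‖x‖)) := by
        refine mul_le_mul ?_ (key.trans ?_) (abs_nonneg _) (by norm_num)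
        · gcongr
        · gcongr
    _ = (16 / 6) / (1 + ‖x‖) := by ring
    _ ≤ 3 / (1 + ‖x‖) := by gcongr; norm_num

/-! ### Growth of the potential kernel -/

theorem abs_sub_le_harmonic {φ : ℤ → ℝ} {C : ℝ}
    (h : ∀ k, |φ (k + 1) - φ k| ≤ C / (1 + |(k : ℝ)|)) (n : ℤ) :
    |φ n - φ 0| ≤ C * harmonic n.natAbs := by
  have hC : 0 ≤ C := by
    have := (abs_nonneg _).trans (h 0)
    simpa using this
  have key : ∀ n : ℕ, |φ n - φ 0| ≤ C * harmonic n ∧ |φ (-n) - φ 0| ≤ C * harmonic n := by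
    intro n
    induction n with
    | zero => simp
    | succ n ih =>
      have h1 := h n
      have h2 := h (-n - 1)
      have h3 : C / (1 + |((-n - 1 : ℤ) : ℝ)|) ≤ C / (n + 1) := by
        push_cast
        rw [show (-(n : ℝ) - 1) = -(n + 1) by ring, abs_neg, abs_of_nonneg (by positivity)]
        exact div_le_div_of_nonneg_left hC (by positivity) (by linarith)
      rw [Int.cast_natCast, Nat.abs_cast, add_comm (1 : ℝ)] at h1
      rw [sub_add_cancel] at h2
      replace h2 := h2.trans h3
      have h4 : C * ((harmonic (n + 1) : ℚ) : ℝ) = C * harmonic n + C / (n + 1) := by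
        rw [harmonic_succ]; push_cast; ring
      rw [h4]
      push_cast
      rw [show -((n : ℤ) + 1) = -n - 1 by ring]
      rw [abs_le] at h1 h2
      constructor <;> rw [abs_le]
      · constructor <;> linarith [(abs_le.mp ih.1).1, (abs_le.mp ih.1).2, h1.1, h1.2]
      · constructor <;> linarith [(abs_le.mp ih.2).1, (abs_le.mp ih.2).2, h2.1, h2.2]
  rcases Int.natAbs_eq n with h' | h'
  · have := (key n.natAbs).1
    rwa [← h'] at this
  · have := (key n.natAbs).2
    rwa [← h'] at this

theorem abs_sub_le_mul_abs {φ : ℤ → ℝ} {B : ℝ} (n : ℤ)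
    (h : ∀ k, |k| ≤ |n| → |φ (k + 1) - φ k| ≤ B) : |φ n - φ 0| ≤ B * |(n : ℝ)| := by
  have key : ∀ m : ℕ, (m : ℤ) ≤ |n| → |φ m - φ 0| ≤ B * m ∧ |φ (-m) - φ 0| ≤ B * m := by
    intro m
    induction m with
    | zero => simp
    | succ m ih =>
      intro hm
      push_cast at hm
      have ih' := ih (by omega)
      have h1 := abs_le.mp (h m (by rw [abs_of_nonneg (by omega)]; omega))
      have h2 := abs_le.mp (h (-m - 1) (by rw [abs_of_nonpos (by omega)]; omega))
      rw [sub_add_cancel] at h2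
      have h3 := abs_le.mp ih'.1
      have h4 := abs_le.mp ih'.2
      push_cast
      rw [show -((m : ℤ) + 1) = -m - 1 by ring]
      constructor <;> rw [abs_le] <;> constructor <;> linarith [h1.1, h1.2, h2.1, h2.2, h3.1, h3.2, h4.1, h4.2]
  have hn : ((n.natAbs : ℕ) : ℝ) = |(n : ℝ)| := by rw [Nat.cast_natAbs, Int.cast_abs]
  have hn' : ((n.natAbs : ℕ) : ℤ) ≤ |n| := by simp
  rw [← hn]
  rcases Int.natAbs_eq n with h' | h'
  · have := (key n.natAbs hn').1
    rwa [← h'] at this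
  · have := (key n.natAbs hn').2
    rwa [← h'] at this

theorem abs_potential_le_log (z : ℤ × ℤ) :
    |potential z| ≤ 6 * (1 + Real.log (1 + ‖z‖)) := by
  obtain ⟨m, n⟩ := z
  have hlog : ∀ k : ℤ, |(k : ℝ)| ≤ ‖((m, n) : ℤ × ℤ)‖ →
      (harmonic k.natAbs : ℝ) ≤ 1 + Real.log (1 + ‖((m, n) : ℤ × ℤ)‖) := by
    intro k hk
    refine (harmonic_le_one_add_log _).trans ?_
    rw [Nat.cast_natAbs, Int.cast_abs]
    gcongr 1 + ?_
    rcases eq_or_ne k 0 with rfl | hk0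
    · have := norm_nonneg ((m, n) : ℤ × ℤ)
      rw [Int.cast_zero, abs_zero, Real.log_zero]
      exact Real.log_nonneg (by linarith)
    · exact Real.log_le_log (abs_pos.mpr (by exact_mod_cast hk0)) (by linarith)
  have h1 := abs_sub_le_harmonic (φ := fun k => potential (k, 0)) (C := 3) (fun k => by
    have := abs_potential_diff_le (k, 0) (1, 0) (Or.inl rfl)
    rw [norm_int_prod] at this
    simpa using this) m
  have h2 := abs_sub_le_harmonic (φ := fun k => potential (m, k)) (C := 3) (fun k => by
    have := abs_potential_diff_le (m, k) (0, 1) (Or.inr rfl)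
    simp only [Prod.mk_add_mk, add_zero] at this
    refine this.trans ?_
    rw [norm_int_prod]
    gcongr
    exact le_max_right _ _) n
  have h3 := hlog m (by rw [norm_int_prod]; exact le_max_left _ _)
  have h4 := hlog n (by rw [norm_int_prod]; exact le_max_right _ _)
  have h5 : potential (0, 0) = 0 := potential_zero
  simp only [h5] at h1
  rw [abs_le] at *
  constructor <;> linarith [h1.1, h1.2, h2.1, h2.2]

theorem one_add_log_le_rpow {ε t : ℝ} (hε : 0 < ε) (ht : 1 ≤ t) :
    1 + Real.log t ≤ (1 + 1 / ε) * t ^ ε := by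
  have h1 := Real.log_le_rpow_div (by linarith : 0 ≤ t) hε
  have h2 := Real.one_le_rpow ht hε.le
  have : (1 + 1 / ε) * t ^ ε = t ^ ε + t ^ ε / ε := by ring
  linarith

theorem abs_potential_le_rpow {ε : ℝ} (hε : 0 < ε) (z : ℤ × ℤ) :
    |potential z| ≤ 6 * (1 + 1 / ε) * (1 + ‖z‖) ^ ε := by
  have := one_add_log_le_rpow hε (by linarith [norm_nonneg z] : 1 ≤ 1 + ‖z‖)
  linarith [abs_potential_le_log z]

/-- A path of at most `2‖y‖` unit steps along the axes stays in the box of radius `‖x‖/2` about `x`,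
where each step costs at most `6/‖x‖`. -/
theorem abs_potential_add_sub_le {x y : ℤ × ℤ} (hx : x ≠ 0) (hy : ‖y‖ ≤ ‖x‖ / 2) :
    |potential (x + y) - potential x| ≤ 12 * ‖y‖ / ‖x‖ := by
  obtain ⟨m, n⟩ := y
  have hx1 := one_le_norm hx
  have hm : |(m : ℝ)| ≤ ‖((m, n) : ℤ × ℤ)‖ := by rw [norm_int_prod]; exact le_max_left _ _
  have hn : |(n : ℝ)| ≤ ‖((m, n) : ℤ × ℤ)‖ := by rw [norm_int_prod]; exact le_max_right _ _
  have hstep : ∀ w e : ℤ × ℤ, ‖w‖ ≤ ‖x‖ / 2 → (e = (1, 0) ∨ e = (0, 1)) →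
      |potential (x + w + e) - potential (x + w)| ≤ 6 / ‖x‖ := by
    intro w e hw he
    refine (abs_potential_diff_le _ e he).trans ?_
    have : ‖x‖ - ‖w‖ ≤ ‖x + w‖ := by
      have := norm_sub_le (x + w) w
      rw [add_sub_cancel_right] at this
      linarith
    rw [div_le_div_iff₀ (by positivity) (by positivity)]
    linarith
  have h1 := abs_sub_le_mul_abs (φ := fun k => potential (x + (k, 0))) (B := 6 / ‖x‖) m
    (fun k hk => by
      have := hstep (k, 0) (1, 0) ?_ (Or.inl rfl)
      · simpa [add_assoc] using this
      · rw [norm_int_prod]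
        have : |(k : ℝ)| ≤ |(m : ℝ)| := by exact_mod_cast hk
        simp only [Int.cast_zero, abs_zero]
        exact max_le (by linarith) (by linarith))
  have h2 := abs_sub_le_mul_abs (φ := fun k => potential (x + (m, k))) (B := 6 / ‖x‖) n
    (fun k hk => by
      have := hstep (m, k) (0, 1) ?_ (Or.inr rfl)
      · simpa [add_assoc] using this
      · rw [norm_int_prod]
        have : |(k : ℝ)| ≤ |(n : ℝ)| := by exact_mod_cast hk
        exact max_le (by linarith) (by linarith))
  have h3 : x + ((0 : ℤ), (0 : ℤ)) = x := add_zero x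
  simp only [h3] at h1
  have h4 : 6 / ‖x‖ * |(m : ℝ)| ≤ 6 / ‖x‖ * ‖((m, n) : ℤ × ℤ)‖ := by gcongr
  have h5 : 6 / ‖x‖ * |(n : ℝ)| ≤ 6 / ‖x‖ * ‖((m, n) : ℤ × ℤ)‖ := by gcongr
  have h6 : 12 * ‖((m, n) : ℤ × ℤ)‖ / ‖x‖ = 2 * (6 / ‖x‖ * ‖((m, n) : ℤ × ℤ)‖) := by ring
  rw [h6]
  rw [abs_le] at *
  constructor <;> linarith [h1.1, h1.2, h2.1, h2.2]

/-- Near `x` this interpolates the gradient bound, which needs `θ ≤ 1`. Far away the logarithmic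
growth is absorbed by `ε`. The lemma converts weighted summability of a density into a decay rate of
its potential. -/
theorem exists_abs_potential_sub_le {θ ε : ℝ} (hθ : 0 < θ) (hθ1 : θ ≤ 1) (hε : 0 < ε) :
    ∃ C, ∀ x y : ℤ × ℤ, x ≠ 0 →
      |potential (x - y) - potential x| ≤ C * (1 + ‖y‖) ^ (θ + ε) * ‖x‖ ^ (-θ) := by
  refine ⟨24 * (3 + 1 / ε), fun x y hx => ?_⟩
  have hx1 := one_le_norm hx
  have hx0 : 0 < ‖x‖ := by linarith
  have hy0 := norm_nonneg y
  have hpow : (1 : ℝ) ≤ (1 + ‖y‖) ^ ε := Real.one_le_rpow (by linarith) hε.le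
  have hεpos : 0 < 1 / ε := by positivity
  have hsplit : 24 * (3 + 1 / ε) * (1 + ‖y‖) ^ (θ + ε) * ‖x‖ ^ (-θ) =
      12 * (3 + 1 / ε) * (1 + ‖y‖) ^ ε * (2 * ((1 + ‖y‖) / ‖x‖) ^ θ) := by
    rw [Real.rpow_add (by linarith), Real.rpow_neg hx0.le, Real.div_rpow (by linarith) hx0.le]
    ring
  rw [hsplit]
  rcases le_or_gt ‖y‖ (‖x‖ / 2) with h | h
  · have h1 := abs_potential_add_sub_le hx (y := -y) (by rwa [norm_neg])
    rw [← sub_eq_add_neg, norm_neg] at h1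
    have h2 : ‖y‖ / ‖x‖ ≤ (‖y‖ / ‖x‖) ^ θ := by
      rcases hy0.eq_or_lt with h0 | h0
      · rw [← h0]; simp [Real.zero_rpow hθ.ne']
      · have := Real.rpow_le_rpow_of_exponent_ge (x := ‖y‖ / ‖x‖) (by positivity)
          (by rw [div_le_one hx0]; linarith) hθ1
        rwa [Real.rpow_one] at this
    have h3 : (‖y‖ / ‖x‖) ^ θ ≤ ((1 + ‖y‖) / ‖x‖) ^ θ := by gcongr; linarith
    have h4 : 0 ≤ ((1 + ‖y‖) / ‖x‖) ^ θ := by positivity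
    calc |potential (x - y) - potential x| ≤ 12 * (‖y‖ / ‖x‖) := by rw [← mul_div_assoc]; exact h1
      _ ≤ 12 * 1 * 1 * (2 * ((1 + ‖y‖) / ‖x‖) ^ θ) := by linarith
      _ ≤ _ := by gcongr; linarith
  · have h1 := abs_potential_le_log (x - y)
    have h2 := abs_potential_le_log x
    have h3 : Real.log (1 + ‖x - y‖) ≤ 2 + Real.log (1 + ‖y‖) := by
      have h4 : 1 + ‖x - y‖ ≤ 3 * (1 + ‖y‖) := by linarith [norm_sub_le x y]
      have h5 : Real.log 3 ≤ 2 := by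
        have := Real.log_le_sub_one_of_pos (by norm_num : (0 : ℝ) < 3)
        linarith
      have h6 := Real.log_le_log (by positivity) h4
      rw [Real.log_mul (by norm_num) (by positivity)] at h6
      linarith
    have h3' : Real.log (1 + ‖x‖) ≤ 2 + Real.log (1 + ‖y‖) := by
      have h4 : 1 + ‖x‖ ≤ 3 * (1 + ‖y‖) := by linarith
      have h5 : Real.log 3 ≤ 2 := by
        have := Real.log_le_sub_one_of_pos (by norm_num : (0 : ℝ) < 3)
        linarith
      have h6 := Real.log_le_log (by positivity) h4
      rw [Real.log_mul (by norm_num) (by positivity)] at h6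
      linarith
    have h7 := one_add_log_le_rpow hε (by linarith : 1 ≤ 1 + ‖y‖)
    have h8 : |potential (x - y) - potential x| ≤ 12 * (3 + 1 / ε) * (1 + ‖y‖) ^ ε := by
      have : 12 * (3 + 1 / ε) * (1 + ‖y‖) ^ ε =
        24 * (1 + ‖y‖) ^ ε + 12 * ((1 + 1 / ε) * (1 + ‖y‖) ^ ε) := by ring
      rw [this]
      rw [abs_le] at *
      constructor <;> linarith [h1.1, h1.2, h2.1, h2.2]
    have h9 : 1 ≤ 2 * ((1 + ‖y‖) / ‖x‖) ^ θ := by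
      have h10 : 1 ≤ 2 * ((1 + ‖y‖) / ‖x‖) := by
        rw [← mul_div_assoc, one_le_div hx0]; linarith
      have h11 := Real.one_le_rpow h10 hθ.le
      rw [Real.mul_rpow (by norm_num) (by positivity)] at h11
      have h12 : (2 : ℝ) ^ θ ≤ 2 := by
        have := Real.rpow_le_rpow_of_exponent_le (by norm_num : (1 : ℝ) ≤ 2) hθ1
        rwa [Real.rpow_one] at this
      have h13 : 0 ≤ ((1 + ‖y‖) / ‖x‖) ^ θ := by positivity
      nlinarith
    exact h8.trans (le_mul_of_one_le_right (by positivity) h9)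

/-! ### Convolution with the potential kernel -/

/-- The logarithmic potential of a density `f` on the lattice. -/
noncomputable def logPotential (f : ℤ × ℤ → ℝ) (x : ℤ × ℤ) : ℝ := ∑' y, potential (x - y) * f y

theorem one_add_norm_sub_rpow_le {ε : ℝ} (hε : 0 ≤ ε) (x y : ℤ × ℤ) :
    (1 + ‖x - y‖) ^ ε ≤ (1 + ‖x‖) ^ ε * (1 + ‖y‖) ^ ε := by
  rw [← Real.mul_rpow (by positivity) (by positivity)]
  refine Real.rpow_le_rpow (by positivity) ?_ hε
  nlinarith [norm_sub_le x y, norm_nonneg x, norm_nonneg y]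

section
variable {f : ℤ × ℤ → ℝ} {ε : ℝ}

theorem summable_of_weighted (hε : 0 < ε) (hf : Summable fun y => |f y| * (1 + ‖y‖) ^ ε) :
    Summable f := by
  refine Summable.of_norm_bounded hf fun y => ?_
  rw [Real.norm_eq_abs]
  exact le_mul_of_one_le_right (abs_nonneg _)
    (Real.one_le_rpow (by linarith [norm_nonneg y]) hε.le)

theorem summable_potential_mul (hε : 0 < ε) (hf : Summable fun y => |f y| * (1 + ‖y‖) ^ ε)
    (x : ℤ × ℤ) : Summable fun y => potential (x - y) * f y := by
  refine Summable.of_norm_bounded (hf.mul_left (6 * (1 + 1 / ε) * (1 + ‖x‖) ^ ε)) fun y => ?_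
  rw [norm_mul, Real.norm_eq_abs, Real.norm_eq_abs]
  calc |potential (x - y)| * |f y|
      ≤ 6 * (1 + 1 / ε) * ((1 + ‖x‖) ^ ε * (1 + ‖y‖) ^ ε) * |f y| := by
        gcongr
        refine (abs_potential_le_rpow hε _).trans ?_
        gcongr
        exact one_add_norm_sub_rpow_le hε.le x y
    _ = _ := by ring

/-- The weight makes all the series converge, so the finite difference operator passes inside the
sum and `Δa = δ₀` applies. -/
theorem laplacian_logPotential (hε : 0 < ε) (hf : Summable fun y => |f y| * (1 + ‖y‖) ^ ε)
    (x : ℤ × ℤ) : laplacian (logPotential f) x = f x := by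
  have hs := summable_potential_mul hε hf
  have h := (((((hs (x + (1, 0))).hasSum.add (hs (x - (1, 0))).hasSum).add
    (hs (x + (0, 1))).hasSum).add (hs (x - (0, 1))).hasSum).sub ((hs x).hasSum.mul_left 4))
  have h2 : HasSum (fun y => delta (x - y) * f y) (f x) := by
    have := hasSum_single (f := fun y => delta (x - y) * f y) x (fun y hy => by
      have : x - y ≠ 0 := sub_ne_zero.mpr hy.symm
      simp [delta, this])
    simpa [delta] using this
  rw [laplacian_eq]
  refine h.unique ?_
  refine Eq.mp (congrArg (fun F => HasSum F (f x)) (funext fun y => ?_)) h2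
  rw [← laplacian_potential, laplacian_eq]
  rw [add_sub_right_comm x (1, 0), add_sub_right_comm x (0, 1), sub_right_comm x (1, 0),
    sub_right_comm x (0, 1)]
  ring

/-- Replace `potential (x - y)` by `potential x` under the sum. For a density of total mass zero
this leaves pure power decay. -/
theorem exists_abs_logPotential_sub_le {θ : ℝ} (hθ : 0 < θ) (hθ1 : θ ≤ 1) (hε : 0 < ε)
    (hf : Summable fun y => |f y| * (1 + ‖y‖) ^ (θ + ε)) :
    ∃ C, ∀ x, x ≠ 0 → |logPotential f x - (∑' y, f y) * potential x| ≤ C * ‖x‖ ^ (-θ) := by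
  obtain ⟨C, hC⟩ := exists_abs_potential_sub_le hθ hθ1 hε
  refine ⟨C * ∑' y, |f y| * (1 + ‖y‖) ^ (θ + ε), fun x hx => ?_⟩
  have hf0 := summable_of_weighted (by linarith) hf
  have hs := summable_potential_mul (by linarith) hf x
  rw [logPotential, ← tsum_mul_right, ← hs.tsum_sub (hf0.mul_right _), mul_right_comm,
    ← tsum_mul_left, ← Real.norm_eq_abs]
  refine tsum_of_norm_bounded (hf.mul_left (C * ‖x‖ ^ (-θ))).hasSum fun y => ?_
  rw [Real.norm_eq_abs, mul_comm (f y), ← sub_mul, abs_mul]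
  calc _ ≤ C * (1 + ‖y‖) ^ (θ + ε) * ‖x‖ ^ (-θ) * |f y| := by gcongr; exact hC x y hx
    _ = _ := by ring

theorem tendsto_norm_sub_cofinite (y : ℤ × ℤ) :
    Tendsto (fun x : ℤ × ℤ => ‖x - y‖) cofinite atTop :=
  tendsto_norm_cofinite.comp (sub_left_injective.tendsto_cofinite)

theorem tendsto_logPotential_diff (hε : 0 < ε) (hf : Summable fun y => |f y| * (1 + ‖y‖) ^ ε)
    {e : ℤ × ℤ} (he : e = (1, 0) ∨ e = (0, 1)) :
    Tendsto (fun x => logPotential f (x + e) - logPotential f x) cofinite (𝓝 0) := by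
  have hf0 := summable_of_weighted hε hf
  have hs := summable_potential_mul hε hf
  have heq : ∀ x, logPotential f (x + e) - logPotential f x =
      ∑' y, (potential (x - y + e) - potential (x - y)) * f y := by
    intro x
    rw [logPotential, logPotential, ← (hs _).tsum_sub (hs _)]
    congr 1
    ext y
    rw [add_sub_right_comm, sub_mul]
  simp only [heq]
  rw [← tsum_zero (α := ℝ) (β := ℤ × ℤ)]
  refine tendsto_tsum_of_dominated_convergence (bound := fun y => 3 * |f y|)
    (hf0.abs.mul_left 3) (fun y => ?_) (Eventually.of_forall fun x y => ?_)
  · have h1 : Tendsto (fun x : ℤ × ℤ => 3 / (1 + ‖x - y‖)) cofinite (𝓝 0) :=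
      tendsto_const_nhds.div_atTop (tendsto_atTop_add_const_left _ _ (tendsto_norm_sub_cofinite y))
    have h2 := squeeze_zero_norm (f := fun x => potential (x - y + e) - potential (x - y))
      (fun x => (abs_potential_diff_le (x - y) e he)) h1
    simpa using h2.mul_const (f y)
  · rw [norm_mul, Real.norm_eq_abs, Real.norm_eq_abs]
    gcongr
    refine (abs_potential_diff_le _ e he).trans ?_
    rw [div_le_iff₀ (by positivity)]
    linarith [norm_nonneg (x - y)]

end

/-! ### The logarithm of the length and the asymptotics of the potential kernel -/

/-- The squared Euclidean length. -/
noncomputable def normSq (x : ℤ × ℤ) : ℝ := (x.1 : ℝ) ^ 2 + (x.2 : ℝ) ^ 2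

theorem log_len (x : ℤ × ℤ) : Real.log (len x) = Real.log (normSq x) / 2 := by
  rw [len, Real.log_sqrt (by positivity), normSq]

theorem norm_sq_le_normSq (x : ℤ × ℤ) : ‖x‖ ^ 2 ≤ normSq x := by
  have h := norm_le_len x
  have h2 : len x ^ 2 = normSq x := Real.sq_sqrt (by positivity)
  rw [← h2]
  gcongr

theorem normSq_le (x : ℤ × ℤ) : normSq x ≤ 2 * ‖x‖ ^ 2 := by
  have h1 : |(x.1 : ℝ)| ≤ ‖x‖ := by rw [norm_int_prod]; exact le_max_left _ _
  have h2 : |(x.2 : ℝ)| ≤ ‖x‖ := by rw [norm_int_prod]; exact le_max_right _ _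
  have h3 := sq_le_sq' (by linarith [abs_nonneg (x.1 : ℝ), norm_nonneg x]) h1
  have h4 := sq_le_sq' (by linarith [abs_nonneg (x.2 : ℝ), norm_nonneg x]) h2
  rw [sq_abs] at h3 h4
  rw [normSq]
  linarith

theorem abs_log_one_add_le {r : ℝ} (hr : |r| ≤ 1 / 2) : |Real.log (1 + r)| ≤ 2 * |r| := by
  have h1 := abs_le.mp hr
  have hpos : 0 < 1 + r := by linarith
  have h2 := Real.log_le_sub_one_of_pos hpos
  have h3 := Real.one_sub_inv_le_log_of_pos hpos
  have h4 : 1 - (1 + r)⁻¹ = r / (1 + r) := by field_simp; ring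
  have h5 : |r / (1 + r)| ≤ 2 * |r| := by
    rw [abs_div, abs_of_pos hpos, div_le_iff₀ hpos]
    nlinarith [abs_nonneg r]
  rw [abs_le]
  constructor
  · linarith [(abs_le.mp h5).1]
  · linarith [le_abs_self r, abs_nonneg r]

theorem normSq_nbr (x : ℤ × ℤ) :
    normSq (x + (1, 0)) = normSq x + (2 * x.1 + 1) ∧
    normSq (x - (1, 0)) = normSq x + (-2 * x.1 + 1) ∧
    normSq (x + (0, 1)) = normSq x + (2 * x.2 + 1) ∧
    normSq (x - (0, 1)) = normSq x + (-2 * x.2 + 1) := by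
  simp only [normSq, Prod.fst_add, Prod.fst_sub, Prod.snd_add, Prod.snd_sub]
  push_cast
  refine ⟨?_, ?_, ?_, ?_⟩ <;> ring

theorem abs_fst_le (x : ℤ × ℤ) : |(x.1 : ℝ)| ≤ ‖x‖ := by
  rw [norm_int_prod]; exact le_max_left _ _

theorem abs_snd_le (x : ℤ × ℤ) : |(x.2 : ℝ)| ≤ ‖x‖ := by
  rw [norm_int_prod]; exact le_max_right _ _

theorem abs_laplacian_log_normSq_le {x : ℤ × ℤ} (hx : 4 ≤ ‖x‖) :
    |laplacian (fun y => Real.log (normSq y)) x| ≤ 6 / normSq x ^ 2 := by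
  have hs := norm_sq_le_normSq x
  obtain ⟨h1, h2, h3, h4⟩ := normSq_nbr x
  obtain ⟨ha1, ha2⟩ := abs_le.mp (abs_fst_le x)
  obtain ⟨hb1, hb2⟩ := abs_le.mp (abs_snd_le x)
  rw [laplacian_eq, h1, h2, h3, h4]
  have hsdef : normSq x = (x.1 : ℝ) ^ 2 + (x.2 : ℝ) ^ 2 := rfl
  set s := normSq x with hs_def
  generalize (x.1 : ℝ) = a at *
  generalize (x.2 : ℝ) = b at *
  have hs16 : 16 ≤ s := by nlinarith
  have p1 : 0 < s + (2 * a + 1) := by nlinarith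
  have p2 : 0 < s + (-2 * a + 1) := by nlinarith
  have p3 : 0 < s + (2 * b + 1) := by nlinarith
  have p4 : 0 < s + (-2 * b + 1) := by nlinarith
  have hs0 : 0 < s := by linarith
  -- Since `a² + b² = s`, the terms of order `s³` and `s` cancel in the product. This is the
  -- discrete form of the harmonicity of `ln|x|` in the plane.
  have hprod : (s + (2 * a + 1)) * (s + (-2 * a + 1)) * (s + (2 * b + 1)) * (s + (-2 * b + 1)) =
      s ^ 4 * (1 + (-2 * s ^ 2 + 16 * a ^ 2 * b ^ 2 + 1) / s ^ 4) := by
    field_simp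
    rw [hsdef]
    ring
  have habs : |(-2 * s ^ 2 + 16 * a ^ 2 * b ^ 2 + 1) / s ^ 4| ≤ 3 / s ^ 2 := by
    rw [abs_div, abs_of_pos (by positivity : 0 < s ^ 4), div_le_div_iff₀ (by positivity)
      (by positivity)]
    have hab : 4 * (a ^ 2 * b ^ 2) ≤ s ^ 2 := by rw [hsdef]; nlinarith [sq_nonneg (a ^ 2 - b ^ 2)]
    have hab0 : 0 ≤ a ^ 2 * b ^ 2 := by positivity
    have : |-2 * s ^ 2 + 16 * a ^ 2 * b ^ 2 + 1| ≤ 3 * s ^ 2 := by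
      rw [abs_le]
      constructor <;> nlinarith
    calc _ ≤ 3 * s ^ 2 * s ^ 2 := by gcongr
      _ = 3 * s ^ 4 := by ring
  have hhalf : 3 / s ^ 2 ≤ 1 / 2 := by
    rw [div_le_div_iff₀ (by positivity) (by norm_num)]
    nlinarith
  have hlog := abs_log_one_add_le (habs.trans hhalf)
  have hr := abs_le.mp (habs.trans hhalf)
  have hsum : Real.log (s + (2 * a + 1)) + Real.log (s + (-2 * a + 1)) +
      Real.log (s + (2 * b + 1)) + Real.log (s + (-2 * b + 1)) - 4 * Real.log s =
      Real.log (1 + (-2 * s ^ 2 + 16 * a ^ 2 * b ^ 2 + 1) / s ^ 4) := by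
    rw [← Real.log_mul p1.ne' p2.ne', ← Real.log_mul (by positivity) p3.ne',
      ← Real.log_mul (by positivity) p4.ne', hprod, Real.log_mul (by positivity) (by linarith),
      Real.log_pow]
    push_cast
    ring
  rw [hsum]
  calc _ ≤ _ := hlog
    _ ≤ 2 * (3 / s ^ 2) := by gcongr
    _ = 6 / s ^ 2 := by ring

theorem abs_log_add_sub_log_le {s d : ℝ} (hs : 0 < s) (hd : |d| ≤ s / 2) :
    |Real.log (s + d) - Real.log s| ≤ 2 * (|d| / s) := by
  have hd' := abs_le.mp hd
  rw [← Real.log_div (by linarith) hs.ne', add_div, div_self hs.ne']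
  refine (abs_log_one_add_le ?_).trans (by rw [abs_div, abs_of_pos hs])
  rw [abs_div, abs_of_pos hs, div_le_iff₀ hs]
  linarith

theorem abs_log_normSq_diff_le {x : ℤ × ℤ} (hx : 6 ≤ ‖x‖) :
    |Real.log (normSq (x + (1, 0))) - Real.log (normSq x)| ≤ 6 / ‖x‖ ∧
    |Real.log (normSq (x - (1, 0))) - Real.log (normSq x)| ≤ 6 / ‖x‖ ∧
    |Real.log (normSq (x + (0, 1))) - Real.log (normSq x)| ≤ 6 / ‖x‖ ∧
    |Real.log (normSq (x - (0, 1))) - Real.log (normSq x)| ≤ 6 / ‖x‖ := by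
  have hs := norm_sq_le_normSq x
  obtain ⟨h1, h2, h3, h4⟩ := normSq_nbr x
  obtain ⟨ha1, ha2⟩ := abs_le.mp (abs_fst_le x)
  obtain ⟨hb1, hb2⟩ := abs_le.mp (abs_snd_le x)
  rw [h1, h2, h3, h4]
  have key : ∀ d : ℝ, |d| ≤ 3 * ‖x‖ →
      |Real.log (normSq x + d) - Real.log (normSq x)| ≤ 6 / ‖x‖ := by
    intro d hd
    have hs0 : 0 < normSq x := by nlinarith
    refine (abs_log_add_sub_log_le hs0 (by nlinarith)).trans ?_
    have : |d| / normSq x ≤ 3 / ‖x‖ := by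
      rw [div_le_div_iff₀ hs0 (by linarith)]
      nlinarith
    calc _ ≤ 2 * (3 / ‖x‖) := by gcongr
      _ = 6 / ‖x‖ := by ring
  refine ⟨key _ ?_, key _ ?_, key _ ?_, key _ ?_⟩ <;> rw [abs_le] <;> constructor <;> linarith

theorem eventually_le_norm (R : ℝ) : ∀ᶠ x : ℤ × ℤ in cofinite, R ≤ ‖x‖ :=
  tendsto_norm_cofinite.eventually_ge_atTop R

theorem tendsto_log_normSq_diff {e : ℤ × ℤ} (he : e = (1, 0) ∨ e = (0, 1)) :
    Tendsto (fun x => Real.log (normSq (x + e)) - Real.log (normSq x)) cofinite (𝓝 0) := by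
  have h0 : Tendsto (fun x : ℤ × ℤ => 6 / ‖x‖) cofinite (𝓝 0) :=
    tendsto_const_nhds.div_atTop tendsto_norm_cofinite
  refine squeeze_zero_norm' ?_ h0
  filter_upwards [eventually_le_norm 6] with x hx
  have := abs_log_normSq_diff_le hx
  rcases he with rfl | rfl
  · exact this.1
  · exact this.2.2.1

theorem exists_abs_laplacian_log_normSq_le : ∃ C, ∀ x : ℤ × ℤ,
    |laplacian (fun y => Real.log (normSq y)) x| ≤ C * (1 + ‖x‖) ^ (-4 : ℝ) := by
  have hfin : {x : ℤ × ℤ | ¬ 4 ≤ ‖x‖}.Finite := by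
    simpa [Filter.eventually_cofinite] using eventually_le_norm 4
  obtain ⟨B, hB⟩ := (hfin.image
    (fun x => |laplacian (fun y => Real.log (normSq y)) x| * (1 + ‖x‖) ^ (4 : ℝ))).bddAbove.exists_ge
    96
  refine ⟨B, fun x => ?_⟩
  have hpos : 0 < 1 + ‖x‖ := by positivity
  rw [Real.rpow_neg hpos.le, ← div_eq_mul_inv, le_div_iff₀ (by positivity)]
  by_cases hx : 4 ≤ ‖x‖
  · refine le_trans ?_ hB.1
    have h1 := abs_laplacian_log_normSq_le hx
    have h2 := norm_sq_le_normSq x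
    have h3 : (1 + ‖x‖) ^ (4 : ℝ) = (1 + ‖x‖) ^ 4 := by norm_cast
    have h4 : (1 + ‖x‖) ^ 4 ≤ 16 * normSq x ^ 2 := by
      calc (1 + ‖x‖) ^ 4 ≤ (2 * ‖x‖) ^ 4 := by gcongr; linarith
        _ = 16 * (‖x‖ ^ 2) ^ 2 := by ring
        _ ≤ _ := by gcongr
    have h5 : 0 < normSq x := by nlinarith
    rw [h3]
    calc _ ≤ 6 / normSq x ^ 2 * (16 * normSq x ^ 2) := by gcongr
      _ = 96 := by field_simp; norm_num
  · exact hB.2 _ ⟨x, hx, rfl⟩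

theorem summable_weighted_of_le {f : ℤ × ℤ → ℝ} {C p ε : ℝ}
    (hf : ∀ x, |f x| ≤ C * (1 + ‖x‖) ^ (-p)) (hp : 2 < p - ε) :
    Summable fun y => |f y| * (1 + ‖y‖) ^ ε := by
  refine Summable.of_nonneg_of_le (fun y => by positivity) (fun y => ?_)
    ((summable_one_add_norm_rpow hp).mul_left C)
  calc |f y| * (1 + ‖y‖) ^ ε ≤ C * (1 + ‖y‖) ^ (-p) * (1 + ‖y‖) ^ ε := by gcongr; exact hf y
    _ = C * (1 + ‖y‖) ^ (-(p - ε)) := by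
      rw [mul_assoc, ← Real.rpow_add (by positivity)]
      congr 2
      ring

/-- `ln|x|²` minus the logarithmic potential of its own Laplacian is harmonic with first differences
vanishing at infinity, hence constant. -/
theorem exists_log_normSq_expansion : ∃ H c C : ℝ, ∀ x, x ≠ 0 →
    |Real.log (normSq x) - (H * potential x + c)| ≤ C / ‖x‖ := by
  obtain ⟨C, hC⟩ := exists_abs_laplacian_log_normSq_le
  set L : ℤ × ℤ → ℝ := fun y => Real.log (normSq y) with hL
  -- The weight exponent is `θ + ε` with `θ = 1` and `ε = 1/2`; decay of order `4` leaves `4 - 3/2 >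
  -- 2`.
  have hs : Summable fun y => |laplacian L y| * (1 + ‖y‖) ^ (1 + 1 / 2 : ℝ) :=
    summable_weighted_of_le hC (by norm_num)
  obtain ⟨C', hC'⟩ := exists_abs_logPotential_sub_le one_pos le_rfl (by norm_num) hs
  have hdiff : ∀ e : ℤ × ℤ, (e = (1, 0) ∨ e = (0, 1)) →
      Tendsto (fun x => (L (x + e) - logPotential (laplacian L) (x + e)) -
        (L x - logPotential (laplacian L) x)) cofinite (𝓝 0) := by
    intro e he
    have := (tendsto_log_normSq_diff he).sub (tendsto_logPotential_diff (by norm_num) hs he)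
    rw [sub_zero] at this
    refine this.congr fun x => ?_
    simp only [hL]
    ring
  have hconst := eq_of_harmonic_of_tendsto_differences
    (u := fun x => L x - logPotential (laplacian L) x)
    (fun x => by rw [laplacian_sub, laplacian_logPotential (by norm_num) hs, sub_self])
    (hdiff _ (Or.inl rfl)) (hdiff _ (Or.inr rfl))
  refine ⟨∑' y, laplacian L y, L 0 - logPotential (laplacian L) 0, C', fun x hx => ?_⟩
  have h1 := hC' x hx
  rw [Real.rpow_neg_one, ← div_eq_mul_inv] at h1
  rw [← hconst x]
  convert h1 using 2
  ring

theorem sum_odd_inv_eq (n : ℕ) : ∑ k ∈ Finset.range n, 1 / (2 * (k : ℝ) + 1) =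
    (harmonic (2 * n) : ℝ) - harmonic n / 2 := by
  induction n with
  | zero => simp
  | succ n ih =>
    rw [Finset.sum_range_succ, ih, show 2 * (n + 1) = 2 * n + 1 + 1 by ring, harmonic_succ,
      harmonic_succ, harmonic_succ]
    push_cast
    field_simp
    ring

theorem tendsto_potential_diagonal :
    Tendsto (fun n : ℕ => potential (n, n) - 1 / (2 * Real.pi) * Real.log n) atTop
      (𝓝 (1 / Real.pi * (Real.eulerMascheroniConstant / 2 + Real.log 2))) := by
  have h1 := Real.tendsto_harmonic_sub_log
  have h2 := h1.comp (tendsto_id.const_mul_atTop' (two_pos : (0 : ℕ) < 2))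
  have h3 := (((h2.sub (h1.div_const 2)).add_const (Real.log 2)).const_mul (1 / Real.pi))
  have e : Real.eulerMascheroniConstant - Real.eulerMascheroniConstant / 2 + Real.log 2 =
    Real.eulerMascheroniConstant / 2 + Real.log 2 := by ring
  rw [e] at h3
  refine h3.congr' ?_
  filter_upwards [eventually_gt_atTop 0] with n hn
  rw [potential_diagonal, sum_odd_inv_eq]
  have : (n : ℝ) ≠ 0 := by positivity
  simp only [Function.comp_apply, id]
  push_cast
  rw [Real.log_mul two_ne_zero this]
  field_simp
  ring

/-- The asymptotic expansion of the potential kernel. -/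
theorem exists_abs_potential_sub_log_le : ∃ C : ℝ, ∀ x, x ≠ 0 →
    |potential x - (1 / (2 * Real.pi) * Real.log (len x) +
      (2 * Real.eulerMascheroniConstant + 3 * Real.log 2) / (4 * Real.pi))| ≤ C / ‖x‖ := by
  obtain ⟨H, c, C, hC⟩ := exists_log_normSq_expansion
  have hpi := Real.pi_pos
  set γ := Real.eulerMascheroniConstant
  have hd : ∀ n : ℕ, 0 < n →
      ‖(Real.log 2 + 2 * Real.log n) - (H * potential (n, n) + c)‖ ≤ C / n := by
    intro n hn
    have hn0 : (((n : ℤ), (n : ℤ)) : ℤ × ℤ) ≠ 0 := by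
      intro h; rw [Prod.ext_iff] at h; simp at h; omega
    have h1 := hC _ hn0
    have h2 : ‖(((n : ℤ), (n : ℤ)) : ℤ × ℤ)‖ = n := by rw [norm_int_prod]; simp
    have h3 : normSq ((n : ℤ), (n : ℤ)) = 2 * (n : ℝ) ^ 2 := by simp [normSq]; ring
    rw [h2, h3, Real.log_mul two_ne_zero (by positivity), Real.log_pow] at h1
    exact_mod_cast h1
  have hlim : Tendsto (fun n : ℕ => (Real.log 2 + 2 * Real.log n) - (H * potential (n, n) + c))
      atTop (𝓝 0) := by
    refine squeeze_zero_norm' ?_ (tendsto_const_div_atTop_nhds_zero_nat C)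
    filter_upwards [eventually_gt_atTop 0] with n hn using hd n hn
  have hlim2 := hlim.add (tendsto_potential_diagonal.const_mul H)
  have hlim3 : Tendsto (fun n : ℕ => (2 - H / (2 * Real.pi)) * Real.log n) atTop
      (𝓝 (c - Real.log 2 + H * (1 / Real.pi * (γ / 2 + Real.log 2)))) := by
    have := hlim2.add_const (c - Real.log 2)
    rw [zero_add, add_comm] at this
    refine this.congr fun n => ?_
    ring
  have hlogtop : Tendsto (fun n : ℕ => Real.log n) atTop atTop :=
    Real.tendsto_log_atTop.comp tendsto_natCast_atTop_atTop
  -- A multiple of `log n` can converge only if the multiple is zero; the limit then determines `c`.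
  have hcoef : 2 - H / (2 * Real.pi) = 0 := by
    have h1 := hlim3.mul hlogtop.inv_tendsto_atTop
    rw [mul_zero] at h1
    refine tendsto_nhds_unique (tendsto_const_nhds.congr' ?_) h1
    filter_upwards [eventually_gt_atTop 1] with n hn
    have : 0 < Real.log n := Real.log_pos (by exact_mod_cast hn)
    simp only [Pi.inv_apply]
    field_simp
  have hH : H = 4 * Real.pi := by
    field_simp at hcoef
    linarith
  have hc : c = -3 * Real.log 2 - 2 * γ := by
    simp only [hcoef, zero_mul] at hlim3
    have := tendsto_nhds_unique hlim3 tendsto_const_nhds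
    rw [hH] at this
    field_simp at this
    linarith
  refine ⟨C, fun x hx => ?_⟩
  have h1 := hC x hx
  rw [log_len]
  have h2 : potential x - (1 / (2 * Real.pi) * (Real.log (normSq x) / 2) +
      (2 * γ + 3 * Real.log 2) / (4 * Real.pi)) =
      -(1 / (4 * Real.pi)) * (Real.log (normSq x) - (H * potential x + c)) := by
    rw [hH, hc]
    field_simp
    ring
  rw [h2, abs_mul, abs_neg, abs_of_pos (by positivity)]
  refine (mul_le_of_le_one_left (abs_nonneg _) ?_).trans h1
  rw [div_le_one (by positivity)]
  linarith [Real.pi_gt_three]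

/-! ### Solving the equation with an integrable weight by minimisation -/

theorem hasSum_mul_delta (f : ℤ × ℤ → ℝ) (c : ℤ × ℤ) :
    HasSum (fun x => f x * delta (x - c)) (f c) := by
  have := hasSum_single (f := fun x => f x * delta (x - c)) c (fun y hy => by
    simp [delta, sub_ne_zero.mpr hy])
  simpa [delta] using this

/-- A line of slope `M` tangent to the exponential; it makes the functional bounded below despite
the linear term at the origin. -/
theorem exists_linear_le_exp {c κ : ℝ} (hc : 0 < c) (hκ : 0 < κ) {M : ℝ} (hM : 0 < M) :
    ∃ K, ∀ s, M * s ≤ 1 / κ * c * Real.exp (κ * s) + K := by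
  refine ⟨-(M / κ * (1 + Real.log (c / M))), fun s => ?_⟩
  have h := Real.add_one_le_exp (κ * s + Real.log (c / M))
  rw [Real.exp_add, Real.exp_log (by positivity)] at h
  have h2 := mul_le_mul_of_nonneg_left h (by positivity : 0 ≤ M / κ)
  have h3 : M / κ * (Real.exp (κ * s) * (c / M)) = 1 / κ * c * Real.exp (κ * s) := by
    field_simp
  have h4 : M / κ * (κ * s + Real.log (c / M) + 1) = M * s + M / κ * (1 + Real.log (c / M)) := by
    field_simp
    ring
  linarith

/-- The energy density of the functional whose minimiser solves `-Δw + g e^{κw} = m δ₀`; the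
constant `K` makes it non-negative at the origin. -/
noncomputable def energyDensity (g : ℤ × ℤ → ℝ) (κ m K : ℝ) (w : ℤ × ℤ → ℝ) (x : ℤ × ℤ) : ℝ :=
  1 / 2 * (w (x + (1, 0)) - w x) ^ 2 + 1 / 2 * (w (x + (0, 1)) - w x) ^ 2 +
    1 / κ * g x * Real.exp (κ * w x) + (K - m * w 0) * delta x

section Minimiser

variable {g : ℤ × ℤ → ℝ} {κ m K : ℝ}

theorem energyDensity_of_ne (w : ℤ × ℤ → ℝ) {x : ℤ × ℤ} (hx : x ≠ 0) :
    energyDensity g κ m K w x = 1 / 2 * (w (x + (1, 0)) - w x) ^ 2 +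
      1 / 2 * (w (x + (0, 1)) - w x) ^ 2 + 1 / κ * g x * Real.exp (κ * w x) := by
  simp [energyDensity, delta, hx]

theorem gradient_le_energyDensity (hg : ∀ x, 0 < g x) (hκ : 0 < κ)
    (hK : ∀ s, m * s ≤ 1 / κ * g 0 * Real.exp (κ * s) + K) (w : ℤ × ℤ → ℝ) (x : ℤ × ℤ) :
    1 / 2 * (w (x + (1, 0)) - w x) ^ 2 + 1 / 2 * (w (x + (0, 1)) - w x) ^ 2 ≤
      energyDensity g κ m K w x := by
  rcases eq_or_ne x 0 with rfl | hx
  · have := hK (w 0)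
    simp only [energyDensity, delta, if_true]
    linarith
  · rw [energyDensity_of_ne w hx]
    have := hg x
    have : 0 ≤ 1 / κ * g x * Real.exp (κ * w x) := by positivity
    linarith

theorem energyDensity_nonneg (hg : ∀ x, 0 < g x) (hκ : 0 < κ)
    (hK : ∀ s, m * s ≤ 1 / κ * g 0 * Real.exp (κ * s) + K) (w : ℤ × ℤ → ℝ) (x : ℤ × ℤ) :
    0 ≤ energyDensity g κ m K w x :=
  le_trans (by positivity) (gradient_le_energyDensity hg hκ hK w x)

theorem continuous_energyDensity (x : ℤ × ℤ) :
    Continuous fun w : ℤ × ℤ → ℝ => energyDensity g κ m K w x := by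
  unfold energyDensity
  fun_prop

theorem summable_energyDensity_zero (hgs : Summable g) :
    Summable (energyDensity g κ m K 0) := by
  have h1 := hgs.mul_left (1 / κ)
  have h2 := (hasSum_mul_delta (fun _ => K) 0).summable
  refine (h1.add h2).congr fun x => ?_
  simp [energyDensity]

theorem exists_bound_of_energyDensity_le (hg : ∀ x, 0 < g x) (hκ : 0 < κ) (hm : 0 < m)
    (hK : ∀ s, m * s ≤ 1 / κ * g 0 * Real.exp (κ * s) + K) (B : ℝ) :
    ∃ R : ℤ × ℤ → ℝ, ∀ w, (∀ x, energyDensity g κ m K w x ≤ B) → ∀ x, |w x| ≤ R x := by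
  -- Slope `2m` instead of `m` leaves a margin `m * w 0`, which bounds `w 0` from above. The lower
  -- bound comes from the linear term itself.
  obtain ⟨K₂, hK₂⟩ := exists_linear_le_exp (hg 0) hκ (by positivity : 0 < 2 * m)
  refine ⟨fun x => (|B| + |K| + |K₂|) / m + (1 + 2 * B) * (|(x.1 : ℝ)| + |(x.2 : ℝ)|),
    fun w hw x => ?_⟩
  have hgrad : ∀ x, 1 / 2 * (w (x + (1, 0)) - w x) ^ 2 + 1 / 2 * (w (x + (0, 1)) - w x) ^ 2 ≤ B :=
    fun x => (gradient_le_energyDensity hg hκ hK w x).trans (hw x)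
  have hB : 0 ≤ B := le_trans (by positivity) (hgrad 0)
  have habs : ∀ r : ℝ, 1 / 2 * r ^ 2 ≤ B → |r| ≤ 1 + 2 * B := by
    intro r hr
    refine abs_le_of_sq_le_sq (by nlinarith) (by linarith)
  have h1 : ∀ x, |w (x + (1, 0)) - w x| ≤ 1 + 2 * B := fun x =>
    habs _ (by nlinarith [hgrad x, sq_nonneg (w (x + (0, 1)) - w x)])
  have h2 : ∀ x, |w (x + (0, 1)) - w x| ≤ 1 + 2 * B := fun x =>
    habs _ (by nlinarith [hgrad x, sq_nonneg (w (x + (1, 0)) - w x)])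
  have hw0 : |w 0| ≤ (|B| + |K| + |K₂|) / m := by
    have h3 := hw 0
    have h4 := hK₂ (w 0)
    have h5 := Real.exp_pos (κ * w 0)
    have hg0 := hg 0
    have h6 : 0 ≤ 1 / κ * g 0 * Real.exp (κ * w 0) := by positivity
    simp only [energyDensity, delta, if_true] at h3
    rw [le_div_iff₀ hm, show |w 0| * m = |w 0 * m| by rw [abs_mul, abs_of_pos hm], abs_le]
    have := sq_nonneg (w (0 + (1, 0)) - w 0)
    have := sq_nonneg (w (0 + (0, 1)) - w 0)
    constructor <;>
      linarith [le_abs_self B, neg_abs_le K, neg_abs_le K₂, le_abs_self K, le_abs_self K₂,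
        abs_nonneg K₂, abs_nonneg K]
  obtain ⟨a, b⟩ := x
  have h3 := abs_sub_le_mul_abs (φ := fun k => w (k, 0)) a (fun k _ => by simpa using h1 (k, 0))
  have h4 := abs_sub_le_mul_abs (φ := fun k => w (a, k)) b (fun k _ => by simpa using h2 (a, k))
  have h5 : |w (0, 0)| ≤ (|B| + |K| + |K₂|) / m := hw0
  simp only [mul_add]
  rw [abs_le] at *
  constructor <;> linarith [h3.1, h3.2, h4.1, h4.2, h5.1, h5.2]

/-- In the product topology the energy is a sum of nonnegative continuous terms, so it is lower
semicontinuous. The sublevel set of the zero function lies in a product of compact intervals. Sums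
in `ENNReal` avoid any summability question. -/
theorem exists_minimiser (hg : ∀ x, 0 < g x) (hgs : Summable g) (hκ : 0 < κ) (hm : 0 < m)
    (hK : ∀ s, m * s ≤ 1 / κ * g 0 * Real.exp (κ * s) + K) :
    ∃ w, Summable (energyDensity g κ m K w) ∧ ∀ v, Summable (energyDensity g κ m K v) →
      ∑' x, energyDensity g κ m K w x ≤ ∑' x, energyDensity g κ m K v x := by
  set D := energyDensity g κ m K with hD
  have hDn : ∀ w x, 0 ≤ D w x := energyDensity_nonneg hg hκ hK
  have hs0 : Summable (D 0) := summable_energyDensity_zero hgs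
  set J : (ℤ × ℤ → ℝ) → ENNReal := fun w => ∑' x, ENNReal.ofReal (D w x) with hJ
  have hJreal : ∀ w, Summable (D w) → J w = ENNReal.ofReal (∑' x, D w x) := fun w hw =>
    (ENNReal.ofReal_tsum_of_nonneg (hDn w) hw).symm
  have hlsc : LowerSemicontinuous J := lowerSemicontinuous_tsum fun x =>
    (ENNReal.continuous_ofReal.comp (continuous_energyDensity x)).lowerSemicontinuous
  have hsum : ∀ w, J w ≤ J 0 → Summable (D w) := by
    intro w hw
    have hfin : J w ≠ ⊤ := ne_top_of_le_ne_top (by rw [hJreal 0 hs0]; exact ENNReal.ofReal_ne_top) hw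
    refine (ENNReal.summable_toReal hfin).congr fun x => ?_
    exact ENNReal.toReal_ofReal (hDn w x)
  obtain ⟨R, hR⟩ := exists_bound_of_energyDensity_le hg hκ hm hK (∑' x, D 0 x)
  set S : Set (ℤ × ℤ → ℝ) := Set.pi Set.univ fun x => Set.Icc (-R x) (R x) with hS
  have hmem : ∀ w, J w ≤ J 0 → w ∈ S := by
    intro w hw x _
    have hws := hsum w hw
    refine abs_le.mp (hR w (fun y => ?_) x)
    refine (hws.le_tsum y fun z _ => hDn w z).trans ?_
    rw [hJreal w hws, hJreal 0 hs0] at hw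
    exact (ENNReal.ofReal_le_ofReal_iff (tsum_nonneg (hDn 0))).mp hw
  obtain ⟨w, -, hmin⟩ := LowerSemicontinuousOn.exists_isMinOn ⟨0, hmem 0 le_rfl⟩
    (isCompact_univ_pi fun x => isCompact_Icc) (hlsc.lowerSemicontinuousOn S)
  have hw0 : J w ≤ J 0 := hmin (hmem 0 le_rfl)
  refine ⟨w, hsum w hw0, fun v hv => ?_⟩
  have hle : J w ≤ J v := by
    rcases le_total (J v) (J 0) with h | h
    · exact hmin (hmem v h)
    · exact hw0.trans h
  rw [hJreal w (hsum w hw0), hJreal v hv] at hle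
  exact (ENNReal.ofReal_le_ofReal_iff (tsum_nonneg (hDn v))).mp hle

theorem summable_exp_of_summable_energyDensity (hg : ∀ x, 0 < g x) (hκ : 0 < κ) {w : ℤ × ℤ → ℝ}
    (hw : Summable (energyDensity g κ m K w)) :
    Summable fun x => g x * Real.exp (κ * w x) := by
  refine (hw.mul_left κ).of_norm_bounded_eventually ?_
  filter_upwards [(Set.finite_singleton (0 : ℤ × ℤ)).compl_mem_cofinite] with x hx
  have := hg x
  rw [energyDensity_of_ne w hx, Real.norm_of_nonneg (by positivity)]
  have h1 : g x * Real.exp (κ * w x) = κ * (1 / κ * g x * Real.exp (κ * w x)) := by field_simp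
  rw [h1]
  refine mul_le_mul_of_nonneg_left ?_ hκ.le
  nlinarith [sq_nonneg (w (x + (1, 0)) - w x), sq_nonneg (w (x + (0, 1)) - w x)]

theorem eq_zero_of_forall_nonneg {φ : ℝ → ℝ} {d : ℝ} (hφ : HasDerivAt φ d 0) (h0 : φ 0 = 0)
    (h : ∀ t, 0 ≤ φ t) : d = 0 :=
  IsLocalMin.hasDerivAt_eq_zero (Eventually.of_forall fun t => by rw [h0]; exact h t) hφ

/-- Adding a constant leaves the gradient terms unchanged, so stationarity in that direction is
exactly the mass identity. -/
theorem hasSum_exp_of_isMin (hg : ∀ x, 0 < g x) (hκ : 0 < κ) {w : ℤ × ℤ → ℝ}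
    (hw : Summable (energyDensity g κ m K w))
    (hmin : ∀ v, Summable (energyDensity g κ m K v) →
      ∑' x, energyDensity g κ m K w x ≤ ∑' x, energyDensity g κ m K v x) :
    HasSum (fun x => g x * Real.exp (κ * w x)) m := by
  have hG := summable_exp_of_summable_energyDensity hg hκ hw
  set S := ∑' x, g x * Real.exp (κ * w x)
  have hsum : ∀ t : ℝ, HasSum (energyDensity g κ m K fun x => w x + t)
      ((∑' x, energyDensity g κ m K w x) + (1 / κ * (Real.exp (κ * t) - 1) * S - m * t)) := by
    intro t
    have h1 := hw.hasSum.add ((hG.hasSum.mul_left (1 / κ * (Real.exp (κ * t) - 1))).sub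
      (hasSum_mul_delta (fun _ => m * t) 0))
    refine Eq.mp (congrArg (fun F => HasSum F _) (funext fun x => ?_)) h1
    rw [energyDensity, energyDensity, sub_zero, mul_add κ (w x) t, Real.exp_add]
    ring
  have hnn : ∀ t : ℝ, 0 ≤ 1 / κ * (Real.exp (κ * t) - 1) * S - m * t := by
    intro t
    have := hmin _ (hsum t).summable
    rw [(hsum t).tsum_eq] at this
    linarith
  have hd : HasDerivAt (fun t : ℝ => 1 / κ * (Real.exp (κ * t) - 1) * S - m * t) (S - m) 0 := by
    have h1 := (((((hasDerivAt_id (0 : ℝ)).const_mul κ).exp.sub_const 1).const_mul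
      (1 / κ)).mul_const S).sub ((hasDerivAt_id (0 : ℝ)).const_mul m)
    refine h1.congr_deriv ?_
    simp
    field_simp
  have := eq_zero_of_forall_nonneg hd (by simp) hnn
  rw [show m = S by linarith]
  exact hG.hasSum

/-- Stationarity under `w + t δ_{x₀}`, which changes only finitely many terms of the energy. -/
theorem equation_of_isMin (hκ : 0 < κ) {w : ℤ × ℤ → ℝ}
    (hw : Summable (energyDensity g κ m K w))
    (hmin : ∀ v, Summable (energyDensity g κ m K v) →
      ∑' x, energyDensity g κ m K w x ≤ ∑' x, energyDensity g κ m K v x) (x₀ : ℤ × ℤ) :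
    -laplacian w x₀ + g x₀ * Real.exp (κ * w x₀) = m * delta x₀ := by
  have hdiff : ∀ e : ℤ × ℤ, e ≠ 0 → ∀ t : ℝ,
      HasSum (fun x => 1 / 2 * ((w (x + e) + t * delta (x + e - x₀)) -
        (w x + t * delta (x - x₀))) ^ 2 - 1 / 2 * (w (x + e) - w x) ^ 2)
        (t * ((w x₀ - w (x₀ - e)) - (w (x₀ + e) - w x₀)) + t ^ 2) := by
    intro e he t
    have h1 := hasSum_mul_delta (fun x => t * (w (x + e) - w x)) (x₀ - e)
    have h2 := hasSum_mul_delta (fun x => t * (w (x + e) - w x)) x₀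
    have h3 := hasSum_mul_delta (fun _ => t ^ 2 / 2) (x₀ - e)
    have h4 := hasSum_mul_delta (fun _ => t ^ 2 / 2) x₀
    have h5 := (h1.sub h2).add (h3.add h4)
    rw [sub_add_cancel] at h5
    have hval : t * (w x₀ - w (x₀ - e)) - t * (w (x₀ + e) - w x₀) + (t ^ 2 / 2 + t ^ 2 / 2) =
      t * ((w x₀ - w (x₀ - e)) - (w (x₀ + e) - w x₀)) + t ^ 2 := by ring
    rw [hval] at h5
    refine Eq.mp (congrArg (fun F => HasSum F _) (funext fun x => ?_)) h5
    have e1 : x - (x₀ - e) = x + e - x₀ := by abel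
    rw [e1]
    -- As `e ≠ 0`, the two indicators are idempotent and orthogonal, so the squared difference
    -- expands without cross terms.
    have hcase : delta (x + e - x₀) ^ 2 = delta (x + e - x₀) ∧
        delta (x - x₀) ^ 2 = delta (x - x₀) ∧ delta (x + e - x₀) * delta (x - x₀) = 0 := by
      refine ⟨?_, ?_, ?_⟩
      · unfold delta; split_ifs <;> norm_num
      · unfold delta; split_ifs <;> norm_num
      · unfold delta
        by_cases hx : x - x₀ = 0
        · have : x + e - x₀ ≠ 0 := by
            rw [add_sub_right_comm, hx, zero_add]; exact he
          simp [this]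
        · simp [hx]
    obtain ⟨c1, c2, c3⟩ := hcase
    generalize delta (x + e - x₀) = a at *
    generalize delta (x - x₀) = b at *
    linear_combination (-(t ^ 2 / 2)) * c1 + (-(t ^ 2 / 2)) * c2 + t ^ 2 * c3
  have hexp : ∀ t : ℝ, HasSum (fun x => 1 / κ * g x * Real.exp (κ * (w x + t * delta (x - x₀))) -
      1 / κ * g x * Real.exp (κ * w x))
      (1 / κ * g x₀ * Real.exp (κ * w x₀) * (Real.exp (κ * t) - 1)) := by
    intro t
    have h1 := hasSum_mul_delta
      (fun x => 1 / κ * g x * Real.exp (κ * w x) * (Real.exp (κ * t) - 1)) x₀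
    refine Eq.mp (congrArg (fun F => HasSum F _) (funext fun x => ?_)) h1
    rw [mul_add, Real.exp_add]
    unfold delta
    split_ifs <;> simp
    ring
  have hpt : ∀ t : ℝ, HasSum (fun x => -(m * (t * delta (0 - x₀))) * delta x)
      (-(m * (t * delta (0 - x₀)))) := by
    intro t
    simpa using hasSum_mul_delta (fun _ => -(m * (t * delta (0 - x₀)))) 0
  have hsym : delta (0 - x₀) = delta x₀ := by simp [delta]
  set φ : ℝ → ℝ := fun t => (t * ((w x₀ - w (x₀ - (1, 0))) - (w (x₀ + (1, 0)) - w x₀)) + t ^ 2) +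
    (t * ((w x₀ - w (x₀ - (0, 1))) - (w (x₀ + (0, 1)) - w x₀)) + t ^ 2) +
    1 / κ * g x₀ * Real.exp (κ * w x₀) * (Real.exp (κ * t) - 1) +
    -(m * (t * delta (0 - x₀))) with hφ
  have hsum : ∀ t : ℝ, HasSum (energyDensity g κ m K fun x => w x + t * delta (x - x₀))
      ((∑' x, energyDensity g κ m K w x) + φ t) := by
    intro t
    have h1 := hw.hasSum.add ((((hdiff (1, 0) (by simp) t).add (hdiff (0, 1) (by simp) t)).add
      (hexp t)).add (hpt t))
    refine Eq.mp (congrArg (fun F => HasSum F _) (funext fun x => ?_)) h1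
    rw [energyDensity, energyDensity]
    ring
  have hnn : ∀ t : ℝ, 0 ≤ φ t := by
    intro t
    have := hmin _ (hsum t).summable
    rw [(hsum t).tsum_eq] at this
    linarith
  have hid := hasDerivAt_id (0 : ℝ)
  have hd := ((((hid.mul_const ((w x₀ - w (x₀ - (1, 0))) - (w (x₀ + (1, 0)) - w x₀))).add
    (hid.pow 2)).add ((hid.mul_const ((w x₀ - w (x₀ - (0, 1))) - (w (x₀ + (0, 1)) - w x₀))).add
    (hid.pow 2))).add (((hid.const_mul κ).exp.sub_const 1).const_mul
    (1 / κ * g x₀ * Real.exp (κ * w x₀)))).add ((hid.mul_const (delta (0 - x₀))).const_mul m).neg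
  have h0 := eq_zero_of_forall_nonneg (φ := φ) hd (by simp [hφ]) hnn
  rw [hsym] at h0
  simp at h0
  rw [laplacian_eq]
  have h1 : κ⁻¹ * g x₀ * Real.exp (κ * w x₀) * κ = g x₀ * Real.exp (κ * w x₀) := by field_simp
  rw [h1] at h0
  linarith

/-- Truncating `w` at height `w 0` keeps the value at the origin, does not increase gradients, and
strictly lowers the exponential term wherever it acts. -/
theorem le_apply_zero_of_isMin (hg : ∀ x, 0 < g x) (hκ : 0 < κ)
    (hK : ∀ s, m * s ≤ 1 / κ * g 0 * Real.exp (κ * s) + K) {w : ℤ × ℤ → ℝ}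
    (hw : Summable (energyDensity g κ m K w))
    (hmin : ∀ v, Summable (energyDensity g κ m K v) →
      ∑' x, energyDensity g κ m K w x ≤ ∑' x, energyDensity g κ m K v x) (x : ℤ × ℤ) :
    w x ≤ w 0 := by
  by_contra! hx
  set v : ℤ × ℤ → ℝ := fun y => min (w y) (w 0) with hv
  have hsq : ∀ y z, (v y - v z) ^ 2 ≤ (w y - w z) ^ 2 := by
    intro y z
    rw [sq_le_sq]
    exact (abs_min_sub_min_le_max _ _ _ _).trans (by simp)
  have hexp : ∀ y, 1 / κ * g y * Real.exp (κ * v y) ≤ 1 / κ * g y * Real.exp (κ * w y) := by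
    intro y
    have := hg y
    gcongr
    exact min_le_left _ _
  have hv0 : v 0 = w 0 := min_self _
  have hle : ∀ y, energyDensity g κ m K v y ≤ energyDensity g κ m K w y := by
    intro y
    rw [energyDensity, energyDensity, hv0]
    linarith [hsq (y + (1, 0)) y, hsq (y + (0, 1)) y, hexp y]
  have hlt : energyDensity g κ m K v x < energyDensity g κ m K w x := by
    have h1 : 1 / κ * g x * Real.exp (κ * v x) < 1 / κ * g x * Real.exp (κ * w x) := by
      have := hg x
      gcongr
      exact min_lt_of_right_lt hx
    rw [energyDensity, energyDensity, hv0]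
    linarith [hsq (x + (1, 0)) x, hsq (x + (0, 1)) x]
  have hvs : Summable (energyDensity g κ m K v) :=
    Summable.of_nonneg_of_le (energyDensity_nonneg hg hκ hK v) hle hw
  exact absurd (hmin v hvs) (not_le.mpr (Summable.tsum_lt_tsum hle hlt hvs hw))

end Minimiser

theorem exists_weighted_solution {g : ℤ × ℤ → ℝ} {κ m : ℝ} (hg : ∀ x, 0 < g x)
    (hgs : Summable g) (hκ : 0 < κ) (hm : 0 < m) :
    ∃ w : ℤ × ℤ → ℝ, (∀ x, -laplacian w x + g x * Real.exp (κ * w x) = m * delta x) ∧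
      HasSum (fun x => g x * Real.exp (κ * w x)) m ∧ ∀ x, w x ≤ w 0 := by
  obtain ⟨K, hK⟩ := exists_linear_le_exp (hg 0) hκ hm
  obtain ⟨w, hw, hmin⟩ := exists_minimiser hg hgs hκ hm hK
  exact ⟨w, equation_of_isMin hκ hw hmin, hasSum_exp_of_isMin hg hκ hw hmin,
    le_apply_zero_of_isMin hg hκ hK hw hmin⟩

/-! ### Solutions with prescribed logarithmic decay -/

theorem exists_abs_potential_sub_log_norm_le : ∃ B, 0 ≤ B ∧ ∀ x : ℤ × ℤ,
    |potential x - 1 / (2 * Real.pi) * Real.log (1 + ‖x‖)| ≤ B := by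
  obtain ⟨C, hC⟩ := exists_abs_potential_sub_log_le
  set c₀ := (2 * Real.eulerMascheroniConstant + 3 * Real.log 2) / (4 * Real.pi)
  have hpi := Real.pi_gt_three
  refine ⟨|C| + |c₀| + 1, by positivity, fun x => ?_⟩
  rcases eq_or_ne x 0 with rfl | hx
  · rw [potential_zero]
    simp
    positivity
  have hx1 := one_le_norm hx
  have h1 := hC x hx
  have h2 : C / ‖x‖ ≤ |C| := by
    rw [div_le_iff₀ (by linarith)]
    nlinarith [le_abs_self C, abs_nonneg C]
  have h3 : |Real.log (len x) - Real.log (1 + ‖x‖)| ≤ 1 := by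
    have h4 := Real.log_le_log (by linarith) (norm_le_len x)
    have h5 := Real.log_le_log (by linarith [norm_le_len x]) (len_le_two_mul_norm x)
    have h6 := Real.log_le_log (by linarith) (by linarith : ‖x‖ ≤ 1 + ‖x‖)
    have h7 := Real.log_le_log (by linarith) (by linarith : 1 + ‖x‖ ≤ 2 * ‖x‖)
    rw [Real.log_mul two_ne_zero (by linarith)] at h5 h7
    have h8 := Real.log_le_sub_one_of_pos (two_pos : (0 : ℝ) < 2)
    rw [abs_le]
    constructor <;> linarith
  have h9 : |1 / (2 * Real.pi) * (Real.log (len x) - Real.log (1 + ‖x‖))| ≤ 1 := by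
    rw [abs_mul, abs_of_pos (by positivity)]
    have : 1 / (2 * Real.pi) ≤ 1 := by rw [div_le_one (by positivity)]; linarith
    exact mul_le_one₀ this (abs_nonneg _) h3
  rw [mul_sub] at h9
  have h10 := le_abs_self c₀
  have h11 := neg_abs_le c₀
  rw [abs_le] at h1 h9 ⊢
  constructor <;> linarith [h1.1, h1.2, h9.1, h9.2]

theorem tendsto_log_one_add_norm :
    Tendsto (fun x : ℤ × ℤ => Real.log (1 + ‖x‖)) cofinite atTop :=
  Real.tendsto_log_atTop.comp (tendsto_atTop_add_const_left _ _ tendsto_norm_cofinite)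

theorem tendsto_potential : Tendsto potential cofinite atTop := by
  obtain ⟨B, -, hB⟩ := exists_abs_potential_sub_log_norm_le
  have h1 : Tendsto (fun x : ℤ × ℤ => 1 / (2 * Real.pi) * Real.log (1 + ‖x‖) + -B) cofinite atTop :=
    tendsto_atTop_add_const_right _ _
      (tendsto_log_one_add_norm.const_mul_atTop (by positivity))
  exact tendsto_atTop_mono (fun x => by linarith [(abs_le.mp (hB x)).1]) h1

theorem exists_exp_neg_potential_le {c : ℝ} (hc : 0 ≤ c) : ∃ C, 0 ≤ C ∧ ∀ x : ℤ × ℤ,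
    Real.exp (-(c * potential x)) ≤ C * (1 + ‖x‖) ^ (-(c / (2 * Real.pi))) := by
  obtain ⟨B, -, hB⟩ := exists_abs_potential_sub_log_norm_le
  refine ⟨Real.exp (c * B), (Real.exp_pos _).le, fun x => ?_⟩
  rw [Real.rpow_def_of_pos (by positivity), ← Real.exp_add, Real.exp_le_exp]
  have := mul_le_mul_of_nonneg_left (abs_le.mp (hB x)).1 hc
  have e : c * (potential x - 1 / (2 * Real.pi) * Real.log (1 + ‖x‖)) =
    c * potential x + Real.log (1 + ‖x‖) * -(c / (2 * Real.pi)) := by ring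
  rw [e] at this
  linarith

/-- The decay rate of the remainder of the solution with logarithmic slope `α`. -/
noncomputable def remainderRate (κ α : ℝ) : ℝ := (α * κ - 4 * Real.pi) / (α * κ + 2 * Real.pi)

theorem weighted_solution_expansion {κ α m : ℝ} (hκ : 0 < κ) (hα : 4 * Real.pi < α * κ)
    (hm : 0 < m) {w : ℤ × ℤ → ℝ}
    (heq : ∀ x, -laplacian w x + Real.exp (-(κ * α * potential x)) * Real.exp (κ * w x) =
      m * delta x)
    (hsum : HasSum (fun x => Real.exp (-(κ * α * potential x)) * Real.exp (κ * w x)) m)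
    (hw0 : ∀ x, w x ≤ w 0) :
    ∃ c C, c ≤ w 0 ∧ ∀ x, x ≠ 0 → |w x - c| ≤ C * ‖x‖ ^ (-remainderRate κ α) := by
  have hpi := Real.pi_pos
  set θ := remainderRate κ α with hθdef
  have hθ : 0 < θ := div_pos (by linarith) (by linarith)
  have hθ1 : θ ≤ 1 := (div_le_one (by linarith)).mpr (by linarith)
  set p := κ * α / (2 * Real.pi) with hp
  have hp2 : 2 < p := by rw [hp, lt_div_iff₀ (by positivity)]; linarith
  -- Here `θ = (p - 2)/(p + 1)` and `p > 2`. With `ε = (p - 2)/3` this gives `p - θ - ε > 2`, the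
  -- condition for weighted summability.
  have hθp : θ < (p - 2) / 3 := by
    have : θ = (p - 2) / (p + 1) := by
      rw [hθdef, remainderRate, hp, div_eq_div_iff (by linarith) (by rw [← hp]; linarith)]
      field_simp
      ring
    rw [this]
    exact div_lt_div_of_pos_left (by linarith) (by norm_num) (by linarith)
  obtain ⟨C, hC0, hC⟩ := exists_exp_neg_potential_le (c := κ * α) (by linarith)
  set f : ℤ × ℤ → ℝ := fun x => Real.exp (-(κ * α * potential x)) * Real.exp (κ * w x) with hf
  set ρ : ℤ × ℤ → ℝ := fun x => f x - m * delta x with hρ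
  have hρbound : ∀ x, |ρ x| ≤ (C * Real.exp (κ * w 0) + m) * (1 + ‖x‖) ^ (-p) := by
    intro x
    have h1 : |f x| ≤ C * Real.exp (κ * w 0) * (1 + ‖x‖) ^ (-p) := by
      rw [abs_of_nonneg (by positivity), mul_right_comm]
      simp only [hf]
      gcongr
      · exact hC x
      · exact hw0 x
    have h2 : |m * delta x| ≤ m * (1 + ‖x‖) ^ (-p) := by
      rw [abs_mul, abs_of_pos hm]
      gcongr
      unfold delta
      split_ifs with hx
      · subst hx; simp
      · rw [abs_zero]; positivity
    calc |ρ x| ≤ |f x| + |m * delta x| := abs_sub _ _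
      _ ≤ _ := by linarith
  have hρs : Summable fun y => |ρ y| * (1 + ‖y‖) ^ (θ + (p - 2) / 3) :=
    summable_weighted_of_le hρbound (by linarith)
  have hε : 0 < (p - 2) / 3 := by linarith
  -- Zero total mass removes the logarithmic term from the potential of `ρ`.
  have hρ0 : ∑' y, ρ y = 0 := by
    have h1 : HasSum (fun x => m * delta (x - 0)) m := hasSum_mul_delta (fun _ => m) 0
    have h2 := hsum.sub h1
    rw [sub_self] at h2
    simp only [sub_zero] at h2
    exact h2.tsum_eq
  obtain ⟨C', hC'⟩ := exists_abs_logPotential_sub_le hθ hθ1 hε hρs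
  simp only [hρ0, zero_mul, sub_zero] at hC'
  have hpow : ∀ x : ℤ × ℤ, x ≠ 0 → ‖x‖ ^ (-θ) ≤ 1 := fun x hx =>
    Real.rpow_le_one_of_one_le_of_nonpos (one_le_norm hx) (by linarith)
  have hconst := eq_of_harmonic_of_le (u := fun x => w x - logPotential ρ x)
    (M := w 0 + |C'| + |logPotential ρ 0|) tendsto_potential potential_zero
    (fun x hx => by rw [laplacian_potential, delta, if_neg hx])
    (fun x => by
      rw [laplacian_sub, laplacian_logPotential (by linarith) hρs]
      simp only [hρ, hf]
      linarith [heq x])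
    (fun x => by
      have h1 := hw0 x
      rcases eq_or_ne x 0 with rfl | hx
      · linarith [neg_abs_le (logPotential ρ 0), abs_nonneg C']
      · have h2 := hC' x hx
        have h3 : C' * ‖x‖ ^ (-θ) ≤ |C'| := by
          have : 0 ≤ ‖x‖ ^ (-θ) := by positivity
          nlinarith [hpow x hx, le_abs_self C', abs_nonneg C']
        linarith [neg_abs_le (logPotential ρ x), abs_nonneg (logPotential ρ 0)])
  have hexp : ∀ x, x ≠ 0 → |w x - (w 0 - logPotential ρ 0)| ≤ C' * ‖x‖ ^ (-θ) := by
    intro x hx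
    rw [← hconst x]
    convert hC' x hx using 2
    ring
  refine ⟨w 0 - logPotential ρ 0, C', ?_, hexp⟩
  have hlim : Tendsto (fun x : ℤ × ℤ => w 0 + C' * ‖x‖ ^ (-θ)) cofinite (𝓝 (w 0 + C' * 0)) :=
    (((tendsto_rpow_neg_atTop hθ).comp tendsto_norm_cofinite).const_mul C').const_add (w 0)
  rw [mul_zero, add_zero] at hlim
  refine ge_of_tendsto hlim ?_
  filter_upwards [(Set.finite_singleton (0 : ℤ × ℤ)).compl_mem_cofinite] with x hx
  linarith [(abs_le.mp (hexp x hx)).1, hw0 x]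

/-- The constant of the kernel exceeds `γ₀/2` by `ln 2/(2π)`, so the required bound on `d` holds
with room to spare when `α > 0`. -/
theorem gammaZero_div_two_le :
    gammaZero / 2 ≤ (2 * Real.eulerMascheroniConstant + 3 * Real.log 2) / (4 * Real.pi) := by
  have hpi := Real.pi_pos
  have : gammaZero / 2 = (2 * Real.eulerMascheroniConstant + Real.log 2) / (4 * Real.pi) := by
    rw [gammaZero]; field_simp; ring
  rw [this]
  gcongr
  linarith [Real.log_pos (one_lt_two : (1 : ℝ) < 2)]

theorem exists_solution {κ α β : ℝ} (hκ : 0 < κ) (hα : 4 * Real.pi < α * κ) (hαβ : α < β) :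
    ∃ u : ℤ × ℤ → ℝ, IsSolution κ β u ∧ HasSum (fun x => Real.exp (κ * u x)) (β - α) ∧
      (∃ B, ∀ x, |u x + α / (2 * Real.pi) * Real.log (1 + ‖x‖)| ≤ B) ∧
      ∃ d C, d ≤ 1 / κ * Real.log (β - α) - gammaZero / 2 * α ∧ ∀ x, x ≠ 0 →
        |u x - (-(α / (2 * Real.pi)) * Real.log (len x) + d)| ≤
          C * ‖x‖ ^ (-remainderRate κ α) := by
  have hpi := Real.pi_pos
  have hm : 0 < β - α := by linarith
  have hα0 : 0 < α := by
    by_contra! h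
    nlinarith
  obtain ⟨C₁, hC₁0, hC₁⟩ := exists_exp_neg_potential_le (c := κ * α) (by positivity)
  have hgs : Summable fun x => Real.exp (-(κ * α * potential x)) := by
    refine Summable.of_nonneg_of_le (fun x => (Real.exp_pos _).le) hC₁
      ((summable_one_add_norm_rpow ?_).mul_left C₁)
    rw [lt_div_iff₀ (by positivity)]
    linarith
  obtain ⟨w, heq, hsum, hw0⟩ := exists_weighted_solution (fun x => Real.exp_pos _) hgs hκ hm
  obtain ⟨c, C, hc, hC⟩ := weighted_solution_expansion hκ hα hm heq hsum hw0
  obtain ⟨C₂, hC₂⟩ := exists_abs_potential_sub_log_le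
  obtain ⟨B, hB0, hB⟩ := exists_abs_potential_sub_log_norm_le
  set c₀ := (2 * Real.eulerMascheroniConstant + 3 * Real.log 2) / (4 * Real.pi) with hc₀
  have hexp : ∀ x, Real.exp (κ * (w x - α * potential x)) =
      Real.exp (-(κ * α * potential x)) * Real.exp (κ * w x) := by
    intro x
    rw [← Real.exp_add]
    congr 1
    ring
  have hθ : 0 < remainderRate κ α := div_pos (by linarith) (by linarith)
  have hθ1 : remainderRate κ α ≤ 1 := (div_le_one (by linarith)).mpr (by linarith)
  -- A single term of a positive series is at most its sum; at the origin the weight is `1`.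
  have hw0le : w 0 ≤ 1 / κ * Real.log (β - α) := by
    have h1 := le_hasSum hsum 0 fun y _ => by positivity
    rw [potential_zero, mul_zero, neg_zero, Real.exp_zero, one_mul] at h1
    have h2 := (Real.le_log_iff_exp_le hm).mpr h1
    rw [one_div, inv_mul_eq_div, le_div_iff₀ hκ]
    linarith
  refine ⟨fun x => w x - α * potential x, fun x => ?_, by simpa only [hexp] using hsum,
    ⟨|c| + |C| + |w 0| + α * B, fun x => ?_⟩, c - α * c₀, C + α * |C₂|, ?_, fun x hx => ?_⟩
  · rw [laplacian_sub, laplacian_const_mul, laplacian_potential, hexp]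
    linarith [heq x]
  · have h1 := mul_le_mul_of_nonneg_left (hB x) hα0.le
    have hwx : |w x| ≤ |c| + |C| + |w 0| := by
      rcases eq_or_ne x 0 with rfl | hx
      · linarith [abs_nonneg c, abs_nonneg C]
      · have h2 := hC x hx
        have h3 : ‖x‖ ^ (-remainderRate κ α) ≤ 1 :=
          Real.rpow_le_one_of_one_le_of_nonpos (one_le_norm hx) (by linarith)
        have h4 : C * ‖x‖ ^ (-remainderRate κ α) ≤ |C| := by
          have : 0 ≤ ‖x‖ ^ (-remainderRate κ α) := by positivity
          nlinarith [le_abs_self C, abs_nonneg C]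
        have h5 := abs_sub_abs_le_abs_sub (w x) c
        linarith [abs_nonneg (w 0)]
    have e : w x - α * potential x + α / (2 * Real.pi) * Real.log (1 + ‖x‖) =
        w x - α * (potential x - 1 / (2 * Real.pi) * Real.log (1 + ‖x‖)) := by ring
    rw [e]
    refine (abs_sub _ _).trans ?_
    rw [abs_mul α, abs_of_pos hα0]
    linarith
  · have := mul_le_mul_of_nonneg_left gammaZero_div_two_le hα0.le
    linarith
  · have e : w x - α * potential x - (-(α / (2 * Real.pi)) * Real.log (len x) + (c - α * c₀)) =
        (w x - c) - α * (potential x - (1 / (2 * Real.pi) * Real.log (len x) + c₀)) := by ring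
    rw [e]
    refine (abs_sub _ _).trans ?_
    rw [abs_mul α, abs_of_pos hα0, add_mul]
    refine add_le_add (hC x hx) ?_
    rw [mul_assoc]
    refine mul_le_mul_of_nonneg_left ((hC₂ x hx).trans ?_) hα0.le
    have hx1 := one_le_norm hx
    calc C₂ / ‖x‖ ≤ |C₂| * ‖x‖ ^ (-1 : ℝ) := by
          rw [Real.rpow_neg_one, ← div_eq_mul_inv]
          gcongr
          exact le_abs_self _
      _ ≤ _ := by gcongr

/-- The remainder is already bounded by the pure power; the logarithmic factor is at least `1` away
from the origin and only weakens the claim. -/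
theorem isBigO_remainder {κ α : ℝ} (hα : 4 * Real.pi < α * κ) {v : ℤ × ℤ → ℝ} {C : ℝ}
    (hv : ∀ x, x ≠ 0 → |v x| ≤ C * ‖x‖ ^ (-remainderRate κ α)) :
    v =O[cofinite] fun x : ℤ × ℤ =>
      len x ^ ((4 * Real.pi - α * κ) / (α * κ + 2 * Real.pi)) *
        Real.log (len x) ^ (2 * Real.pi / (α * κ + 2 * Real.pi)) := by
  have hpi := Real.pi_pos
  have hθ : (4 * Real.pi - α * κ) / (α * κ + 2 * Real.pi) = -remainderRate κ α := by
    rw [remainderRate, ← neg_div, neg_sub]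
  have hθ0 : 0 < remainderRate κ α := div_pos (by linarith) (by linarith)
  rw [hθ]
  set θ := remainderRate κ α
  refine IsBigO.of_bound (|C| * 2 ^ θ) ?_
  filter_upwards [eventually_le_norm 3] with x hx
  have hx0 : x ≠ 0 := by
    rintro rfl
    simp at hx
    linarith
  have hlen := norm_le_len x
  have hlog : 1 ≤ Real.log (len x) := by
    rw [Real.le_log_iff_exp_le (by linarith)]
    linarith [Real.exp_one_lt_d9]
  have hlogp : 1 ≤ Real.log (len x) ^ (2 * Real.pi / (α * κ + 2 * Real.pi)) :=
    Real.one_le_rpow hlog (div_nonneg (by linarith) (by linarith))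
  have hlen0 : 0 < len x := by linarith
  have hnorm : ‖x‖ ^ (-θ) ≤ 2 ^ θ * len x ^ (-θ) := by
    have h1 := Real.rpow_le_rpow_of_nonpos hlen0 (len_le_two_mul_norm x) (by linarith : -θ ≤ 0)
    rw [Real.mul_rpow (by norm_num) (by linarith), Real.rpow_neg (by norm_num)] at h1
    rwa [inv_mul_le_iff₀ (by positivity)] at h1
  rw [Real.norm_eq_abs, Real.norm_of_nonneg (by positivity)]
  calc |v x| ≤ C * ‖x‖ ^ (-θ) := hv x hx0
    _ ≤ |C| * (2 ^ θ * len x ^ (-θ)) := by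
        gcongr
        exact le_abs_self C
    _ ≤ |C| * (2 ^ θ * len x ^ (-θ)) *
        Real.log (len x) ^ (2 * Real.pi / (α * κ + 2 * Real.pi)) :=
      le_mul_of_one_le_right (by positivity) hlogp
    _ = _ := by ring

/-- Solutions with a faster logarithmic decay are smaller. -/
theorem solution_lt_solution {κ β α₁ α₂ : ℝ} (hκ : 0 < κ) (h12 : α₁ < α₂) {u₁ u₂ : ℤ × ℤ → ℝ}
    (h1 : IsSolution κ β u₁) (h2 : IsSolution κ β u₂) {B₁ B₂ : ℝ}
    (hB₁ : ∀ x, |u₁ x + α₁ / (2 * Real.pi) * Real.log (1 + ‖x‖)| ≤ B₁)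
    (hB₂ : ∀ x, |u₂ x + α₂ / (2 * Real.pi) * Real.log (1 + ‖x‖)| ≤ B₂) (x : ℤ × ℤ) :
    u₂ x < u₁ x := by
  have hpi := Real.pi_pos
  have key := lt_of_laplacian_nonneg (z := fun y => u₂ y - u₁ y) (c := 0) ?_ ?_ x
  · linarith
  · have hpos : 0 < (α₂ - α₁) / (2 * Real.pi) := div_pos (by linarith) (by positivity)
    filter_upwards [tendsto_log_one_add_norm.eventually_gt_atTop
      ((B₁ + B₂) / ((α₂ - α₁) / (2 * Real.pi)))] with y hy
    rw [div_lt_iff₀ hpos, mul_div_assoc', div_eq_mul_one_div] at hy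
    have := (abs_le.mp (hB₁ y)).1
    have := (abs_le.mp (hB₂ y)).2
    have e1 : α₁ / (2 * Real.pi) * Real.log (1 + ‖y‖) =
      α₁ * Real.log (1 + ‖y‖) * (1 / (2 * Real.pi)) := by ring
    have e2 : α₂ / (2 * Real.pi) * Real.log (1 + ‖y‖) =
      α₂ * Real.log (1 + ‖y‖) * (1 / (2 * Real.pi)) := by ring
    have e3 : Real.log (1 + ‖y‖) * (α₂ - α₁) * (1 / (2 * Real.pi)) =
      α₂ * Real.log (1 + ‖y‖) * (1 / (2 * Real.pi)) -
        α₁ * Real.log (1 + ‖y‖) * (1 / (2 * Real.pi)) := by ring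
    linarith
  · intro y hy
    rw [laplacian_sub]
    have h3 := h1 y
    have h4 := h2 y
    -- The nonlinearity is increasing, so `u₂ - u₁` is subharmonic wherever it is nonnegative.
    have h5 : Real.exp (κ * u₁ y) ≤ Real.exp (κ * u₂ y) := by
      gcongr
      linarith
    linarith

/-! ### Barriers for the critical decay -/

theorem log_one_add_quadratic {e : ℝ} (he : |e| ≤ 1 / 8) :
    e - 3 / 4 * e ^ 2 ≤ Real.log (1 + e) ∧ Real.log (1 + e) ≤ e - 1 / 4 * e ^ 2 := by
  have h := Real.abs_log_sub_add_sum_range_le (x := -e) (by rw [abs_neg]; linarith) 2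
  rw [abs_neg, sub_neg_eq_add] at h
  simp only [Finset.sum_range_succ, Finset.sum_range_zero] at h
  have h2 : |e| ^ (2 + 1) / (1 - |e|) ≤ 1 / 4 * e ^ 2 := by
    rw [div_le_iff₀ (by linarith), ← sq_abs e]
    nlinarith [abs_nonneg e, sq_nonneg |e|]
  have h3 := abs_le.mp (h.trans h2)
  norm_num at h3
  constructor <;> linarith [h3.1, h3.2]

theorem two_mul_abs_div_le_abs_log_sub {s a : ℝ} (hs : 2 * |a| + 1 ≤ s) :
    2 * |a| / s ≤ |Real.log (s + (2 * a + 1)) - Real.log (s + (-2 * a + 1))| := by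
  have key : ∀ b : ℝ, 0 ≤ b → 2 * b + 1 ≤ s →
      2 * b / s ≤ Real.log (s + (2 * b + 1)) - Real.log (s + (-2 * b + 1)) := by
    intro b hb hbs
    have h1 : 0 < s + (2 * b + 1) := by linarith
    have h2 : 0 < s + (-2 * b + 1) := by linarith
    rw [← Real.log_div h1.ne' h2.ne']
    refine le_trans ?_ (Real.one_sub_inv_le_log_of_pos (by positivity))
    rw [inv_div, one_sub_div h1.ne', div_le_div_iff₀ (by linarith) h1]
    nlinarith
  rcases abs_cases a with ⟨h, h'⟩ | ⟨h, h'⟩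
  · rw [h] at hs ⊢
    exact (key a h' hs).trans (le_abs_self _)
  · rw [h] at hs ⊢
    rw [abs_sub_comm]
    have := key (-a) (by linarith) hs
    rw [show (2 * -a + 1 : ℝ) = -2 * a + 1 by ring, show (-2 * -a + 1 : ℝ) = 2 * a + 1 by ring]
      at this
    exact this.trans (le_abs_self _)

/-- The discrete squared gradient of `ln|x|²` is comparable to `1/|x|²`. The lower bound drives
`laplacian_lower_barrier`, the upper bound `laplacian_upper_barrier`. -/
theorem sum_sq_log_normSq_diff {x : ℤ × ℤ} (hx : 6 ≤ ‖x‖) :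
    2 / normSq x ≤ (Real.log (normSq (x + (1, 0))) - Real.log (normSq x)) ^ 2 +
        (Real.log (normSq (x - (1, 0))) - Real.log (normSq x)) ^ 2 +
        (Real.log (normSq (x + (0, 1))) - Real.log (normSq x)) ^ 2 +
        (Real.log (normSq (x - (0, 1))) - Real.log (normSq x)) ^ 2 ∧
      (Real.log (normSq (x + (1, 0))) - Real.log (normSq x)) ^ 2 +
        (Real.log (normSq (x - (1, 0))) - Real.log (normSq x)) ^ 2 +
        (Real.log (normSq (x + (0, 1))) - Real.log (normSq x)) ^ 2 +
        (Real.log (normSq (x - (0, 1))) - Real.log (normSq x)) ^ 2 ≤ 288 / normSq x := by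
  have hN := norm_sq_le_normSq x
  have hs0 : 0 < normSq x := by nlinarith
  constructor
  · obtain ⟨h1, h2, h3, h4⟩ := normSq_nbr x
    have ha := two_mul_abs_div_le_abs_log_sub (s := normSq x) (a := x.1)
      (by nlinarith [abs_fst_le x])
    have hb := two_mul_abs_div_le_abs_log_sub (s := normSq x) (a := x.2)
      (by nlinarith [abs_snd_le x])
    rw [h1, h2, h3, h4]
    have hsq : ∀ r t : ℝ, 0 ≤ r → r ≤ |t| → r ^ 2 ≤ t ^ 2 := by
      intro r t hr h
      rw [← sq_abs t]
      gcongr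
    have ha2 := hsq _ _ (by positivity) ha
    have hb2 := hsq _ _ (by positivity) hb
    have htot : (2 * |(x.1 : ℝ)| / normSq x) ^ 2 + (2 * |(x.2 : ℝ)| / normSq x) ^ 2 =
        4 / normSq x := by
      rw [div_pow, div_pow, mul_pow, mul_pow, sq_abs, sq_abs]
      have : normSq x = (x.1 : ℝ) ^ 2 + (x.2 : ℝ) ^ 2 := rfl
      field_simp
      rw [this]
      ring
    have e : 4 / normSq x = 2 * (2 / normSq x) := by ring
    generalize Real.log (normSq x + (2 * x.1 + 1)) = p1 at *
    generalize Real.log (normSq x + (-2 * x.1 + 1)) = p2 at *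
    generalize Real.log (normSq x + (2 * x.2 + 1)) = p3 at *
    generalize Real.log (normSq x + (-2 * x.2 + 1)) = p4 at *
    generalize Real.log (normSq x) = p at *
    -- Opposite neighbours satisfy `(p1-p)² + (p2-p)² ≥ (p1-p2)²/2`, and the two squared central
    -- differences total at least `4 / normSq x`.
    nlinarith [sq_nonneg ((p1 - p) + (p2 - p)), sq_nonneg ((p3 - p) + (p4 - p))]
  · obtain ⟨h1, h2, h3, h4⟩ := abs_log_normSq_diff_le hx
    have hsq : ∀ t : ℝ, |t| ≤ 6 / ‖x‖ → t ^ 2 ≤ 72 / normSq x := by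
      intro t ht
      rw [← sq_abs]
      calc |t| ^ 2 ≤ (6 / ‖x‖) ^ 2 := by gcongr
        _ = 36 / ‖x‖ ^ 2 := by rw [div_pow]; norm_num
        _ ≤ 72 / normSq x := by
            rw [div_le_div_iff₀ (by nlinarith) hs0]
            nlinarith [normSq_le x]
    have e : 288 / normSq x = 4 * (72 / normSq x) := by ring
    linarith [hsq _ h1, hsq _ h2, hsq _ h3, hsq _ h4]

theorem one_le_log_normSq {x : ℤ × ℤ} (hx : 3 ≤ ‖x‖) : 1 ≤ Real.log (normSq x) := by
  have hN := norm_sq_le_normSq x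
  rw [Real.le_log_iff_exp_le (by nlinarith)]
  nlinarith [Real.exp_one_lt_d9]

theorem log_normSq_nonneg (x : ℤ × ℤ) : 0 ≤ Real.log (normSq x) := by
  rcases eq_or_ne x 0 with rfl | hx
  · simp [normSq]
  · refine Real.log_nonneg ?_
    nlinarith [norm_sq_le_normSq x, one_le_norm hx]

/-- With `A = ln|x|²`, second-order expansion gives `Δ ln A ≈ ΔA/A - |∇A|²/(2A²)`. The constants are
`3/4 · 288` and `1/4 · 2`. -/
theorem laplacian_log_log_normSq {x : ℤ × ℤ} (hx : 48 ≤ ‖x‖) :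
    laplacian (fun y => Real.log (normSq y)) x / Real.log (normSq x) -
        216 / (normSq x * Real.log (normSq x) ^ 2) ≤
      laplacian (fun y => Real.log (Real.log (normSq y))) x ∧
    laplacian (fun y => Real.log (Real.log (normSq y))) x ≤
      laplacian (fun y => Real.log (normSq y)) x / Real.log (normSq x) -
        1 / (2 * (normSq x * Real.log (normSq x) ^ 2)) := by
  have hA := one_le_log_normSq (by linarith : 3 ≤ ‖x‖)
  obtain ⟨h1, h2, h3, h4⟩ := abs_log_normSq_diff_le (by linarith : 6 ≤ ‖x‖)
  obtain ⟨hlo, hhi⟩ := sum_sq_log_normSq_diff (by linarith : 6 ≤ ‖x‖)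
  have hN := norm_sq_le_normSq x
  have hs0 : 0 < normSq x := by nlinarith
  rw [laplacian_eq, laplacian_eq]
  generalize Real.log (normSq (x + (1, 0))) = p1 at *
  generalize Real.log (normSq (x - (1, 0))) = p2 at *
  generalize Real.log (normSq (x + (0, 1))) = p3 at *
  generalize Real.log (normSq (x - (0, 1))) = p4 at *
  generalize Real.log (normSq x) = A at *
  have hA0 : 0 < A := by linarith
  have hsmall : 6 / ‖x‖ ≤ 1 / 8 := by
    rw [div_le_div_iff₀ (by linarith) (by norm_num)]
    linarith
  have key : ∀ q : ℝ, |q - A| ≤ 6 / ‖x‖ →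
      (q - A) / A - 3 / 4 * ((q - A) ^ 2 / A ^ 2) ≤ Real.log q - Real.log A ∧
      Real.log q - Real.log A ≤ (q - A) / A - 1 / 4 * ((q - A) ^ 2 / A ^ 2) := by
    intro q hq
    have hq' := abs_le.mp (hq.trans hsmall)
    have he : |(q - A) / A| ≤ 1 / 8 := by
      rw [abs_div, abs_of_pos hA0, div_le_iff₀ hA0]
      linarith
    have hl := log_one_add_quadratic he
    rw [one_add_div hA0.ne', add_sub_cancel, Real.log_div (by linarith) hA0.ne', div_pow] at hl
    exact hl
  have k1 := key p1 h1
  have k2 := key p2 h2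
  have k3 := key p3 h3
  have k4 := key p4 h4
  have hlin : (p1 + p2 + p3 + p4 - 4 * A) / A =
    (p1 - A) / A + (p2 - A) / A + (p3 - A) / A + (p4 - A) / A := by ring
  have hsumdiv : ((p1 - A) ^ 2 + (p2 - A) ^ 2 + (p3 - A) ^ 2 + (p4 - A) ^ 2) / A ^ 2 =
    (p1 - A) ^ 2 / A ^ 2 + (p2 - A) ^ 2 / A ^ 2 + (p3 - A) ^ 2 / A ^ 2 + (p4 - A) ^ 2 / A ^ 2 := by
    ring
  have hlo' := div_le_div_of_nonneg_right hlo (sq_nonneg A)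
  have hhi' := div_le_div_of_nonneg_right hhi (sq_nonneg A)
  rw [hsumdiv, div_div] at hlo' hhi'
  have e1 : 216 / (normSq x * A ^ 2) = 3 / 4 * (288 / (normSq x * A ^ 2)) := by ring
  have e2 : 1 / (2 * (normSq x * A ^ 2)) = 1 / 4 * (2 / (normSq x * A ^ 2)) := by
    field_simp
    norm_num
  rw [hlin, e1, e2]
  constructor <;> linarith [k1.1, k1.2, k2.1, k2.2, k3.1, k3.2, k4.1, k4.2]

theorem exists_mul_log_sq_le (K : ℝ) : ∃ R, ∀ x : ℤ × ℤ, R ≤ ‖x‖ →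
    K * Real.log (normSq x) ^ 2 ≤ normSq x := by
  have h := (Real.isLittleO_pow_log_id_atTop (n := 2)).bound (c := 1 / (|K| + 1)) (by positivity)
  obtain ⟨R, hR⟩ := eventually_atTop.mp h
  refine ⟨max R 1, fun x hx => ?_⟩
  have h1 : R ≤ ‖x‖ := (le_max_left _ _).trans hx
  have h2 : 1 ≤ ‖x‖ := (le_max_right _ _).trans hx
  have hN := norm_sq_le_normSq x
  have h3 := hR (normSq x) (by nlinarith)
  have hs0 : 0 < normSq x := by nlinarith
  rw [Real.norm_of_nonneg (by positivity), id, Real.norm_of_nonneg hs0.le, one_div,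
    inv_mul_eq_div, le_div_iff₀ (by positivity)] at h3
  nlinarith [le_abs_self K, sq_nonneg (Real.log (normSq x))]

/-- In units of `1/(s ln² s)`, with `s = |x|²`, the contributions are `6` from `ln s` and `2 (6 +
216)` from `2 ln ln s`. -/
theorem laplacian_upper_barrier : ∃ R, ∀ x : ℤ × ℤ, R ≤ ‖x‖ → ∀ C,
    laplacian (fun y => -1 * Real.log (normSq y) - 2 * Real.log (Real.log (normSq y)) + C) x ≤
      450 / (normSq x * Real.log (normSq x) ^ 2) := by
  obtain ⟨R, hR⟩ := exists_mul_log_sq_le 1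
  refine ⟨max R 48, fun x hx C => ?_⟩
  have h48 : 48 ≤ ‖x‖ := (le_max_right _ _).trans hx
  have hs := hR x ((le_max_left _ _).trans hx)
  have hA := one_le_log_normSq (by linarith : 3 ≤ ‖x‖)
  have hΔ := abs_le.mp (abs_laplacian_log_normSq_le (by linarith : 4 ≤ ‖x‖))
  have hll := (laplacian_log_log_normSq h48).1
  rw [laplacian_add, laplacian_sub, laplacian_const_mul, laplacian_const_mul, laplacian_const]
  have hN := norm_sq_le_normSq x
  have hs0 : 0 < normSq x := by nlinarith
  generalize laplacian (fun y => Real.log (normSq y)) x = D at *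
  generalize laplacian (fun y => Real.log (Real.log (normSq y))) x = E at *
  generalize Real.log (normSq x) = A at *
  have h1 : 6 / normSq x ^ 2 ≤ 6 / (normSq x * A ^ 2) := by
    rw [sq (normSq x)]
    gcongr
    linarith
  have h2 : -(6 / (normSq x * A ^ 2)) ≤ D / A := by
    have : |D / A| ≤ |D| := by
      rw [abs_div, abs_of_pos (by linarith : 0 < A)]
      exact div_le_self (abs_nonneg _) hA
    have h3 : |D| ≤ 6 / (normSq x * A ^ 2) := (abs_le.mpr hΔ).trans h1
    linarith [(abs_le.mp (this.trans h3)).1]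
  have e1 : 216 / (normSq x * A ^ 2) = 36 * (6 / (normSq x * A ^ 2)) := by ring
  have e2 : 450 / (normSq x * A ^ 2) = 75 * (6 / (normSq x * A ^ 2)) := by ring
  rw [e1] at hll
  rw [e2]
  linarith [hΔ.1]

theorem laplacian_lower_barrier (p₁ : ℝ) :
    ∃ R, ∀ x : ℤ × ℤ, R ≤ ‖x‖ → ∀ C p, 0 ≤ p → p ≤ p₁ →
    1 / (2 * (normSq x * Real.log (normSq x) ^ 2)) ≤
      laplacian (fun y => -p * Real.log (normSq y) - 2 * Real.log (Real.log (normSq y)) + C) x := by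
  -- The concave term gains `1/(s ln² s)`; the errors total at most `6 (p₁ + 2)/s²`, and this factor
  -- makes them at most half the gain.
  obtain ⟨R, hR⟩ := exists_mul_log_sq_le (12 * (p₁ + 2))
  refine ⟨max R 48, fun x hx C p hp0 hp => ?_⟩
  have h48 : 48 ≤ ‖x‖ := (le_max_right _ _).trans hx
  have hs := hR x ((le_max_left _ _).trans hx)
  have hA := one_le_log_normSq (by linarith : 3 ≤ ‖x‖)
  have hΔ := abs_le.mp (abs_laplacian_log_normSq_le (by linarith : 4 ≤ ‖x‖))
  have hll := (laplacian_log_log_normSq h48).2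
  rw [laplacian_add, laplacian_sub, laplacian_const_mul, laplacian_const_mul, laplacian_const]
  have hN := norm_sq_le_normSq x
  have hs0 : 0 < normSq x := by nlinarith
  generalize laplacian (fun y => Real.log (normSq y)) x = D at *
  generalize laplacian (fun y => Real.log (Real.log (normSq y))) x = E at *
  generalize Real.log (normSq x) = A at *
  have h1 : (p₁ + 2) * (6 / normSq x ^ 2) ≤ 1 / (2 * (normSq x * A ^ 2)) := by
    rw [← mul_div_assoc, div_le_div_iff₀ (by positivity) (by positivity)]
    nlinarith
  have h2 : D / A ≤ 6 / normSq x ^ 2 := by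
    have : |D / A| ≤ |D| := by
      rw [abs_div, abs_of_pos (by linarith : 0 < A)]
      exact div_le_self (abs_nonneg _) hA
    exact (le_abs_self _).trans (this.trans (abs_le.mpr hΔ))
  have h3 : p * D ≤ p₁ * (6 / normSq x ^ 2) :=
    (mul_le_mul_of_nonneg_left hΔ.2 hp0).trans (by gcongr)
  linarith

theorem exp_barrier {x : ℤ × ℤ} (hx : 3 ≤ ‖x‖) (p C : ℝ) :
    Real.exp (-p * Real.log (normSq x) - 2 * Real.log (Real.log (normSq x)) + C) =
      Real.exp C * Real.exp (-(p - 1) * Real.log (normSq x)) /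
        (normSq x * Real.log (normSq x) ^ 2) := by
  have hA := one_le_log_normSq hx
  have hs0 : 0 < normSq x := by nlinarith [norm_sq_le_normSq x]
  rw [show -p * Real.log (normSq x) - 2 * Real.log (Real.log (normSq x)) + C =
    C + -(p - 1) * Real.log (normSq x) - (Real.log (normSq x) +
      2 * Real.log (Real.log (normSq x))) by ring, Real.exp_sub, Real.exp_add, Real.exp_add,
    Real.exp_log hs0, two_mul (Real.log (Real.log _)), Real.exp_add, Real.exp_log (by linarith), sq]

theorem exists_forall_norm_lt_le (F : ℤ × ℤ → ℝ) (R b : ℝ) :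
    ∃ C, b ≤ C ∧ ∀ x : ℤ × ℤ, ‖x‖ < R → F x ≤ C := by
  have hfin : {x : ℤ × ℤ | ¬ R ≤ ‖x‖}.Finite := by
    simpa [Filter.eventually_cofinite] using eventually_le_norm R
  obtain ⟨C, h1, h2⟩ := (hfin.image F).bddAbove.exists_ge b
  exact ⟨C, h1, fun x hx => h2 _ ⟨x, not_le.mpr hx, rfl⟩⟩

theorem log_normSq_bounds {x : ℤ × ℤ} (hx : x ≠ 0) :
    2 * Real.log (1 + ‖x‖) - 2 ≤ Real.log (normSq x) ∧
      Real.log (normSq x) ≤ 2 * Real.log (1 + ‖x‖) + 1 := by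
  have hx1 := one_le_norm hx
  have h1 := Real.log_le_log (by positivity) (norm_sq_le_normSq x)
  have h2 := Real.log_le_log (by nlinarith [norm_sq_le_normSq x]) (normSq_le x)
  have h3 := Real.log_le_log (by linarith) (by linarith : 1 + ‖x‖ ≤ 2 * ‖x‖)
  have h4 := Real.log_le_log (by linarith) (by linarith : ‖x‖ ≤ 1 + ‖x‖)
  have h5 := Real.log_le_sub_one_of_pos (two_pos : (0 : ℝ) < 2)
  rw [Real.log_pow] at h1
  rw [Real.log_mul two_ne_zero (by positivity), Real.log_pow] at h2
  rw [Real.log_mul two_ne_zero (by positivity)] at h3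
  push_cast at h1 h2
  constructor <;> linarith

/-- For large `C` the barrier is a supersolution of `Δψ = κ e^ψ` outside a ball and dominates inside
it by the bound `M`. At infinity the solution decays with a strictly larger slope. The constants do
not depend on `α`, so the estimate survives the limit to `α₀`. -/
theorem solution_le_upper_barrier {κ : ℝ} (hκ : 0 < κ) (M : ℝ) :
    ∃ R C : ℝ, ∀ (α β B : ℝ) (u : ℤ × ℤ → ℝ), 4 * Real.pi < α * κ → IsSolution κ β u →
      (∀ x, |u x + α / (2 * Real.pi) * Real.log (1 + ‖x‖)| ≤ B) → (∀ x, u x ≤ M) →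
      ∀ x, R ≤ ‖x‖ →
        κ * u x ≤ -1 * Real.log (normSq x) - 2 * Real.log (Real.log (normSq x)) + C := by
  obtain ⟨R₀, hR₀⟩ := laplacian_upper_barrier
  set R := max R₀ 3 with hR
  obtain ⟨C, hC1, hC2⟩ := exists_forall_norm_lt_le
    (fun x => κ * M + Real.log (normSq x) + 2 * Real.log (Real.log (normSq x)) + 1) R
    (Real.log (450 / κ))
  refine ⟨R, C, fun α β B u hα hu hB hM x _ => ?_⟩
  have hpi := Real.pi_pos
  have key := lt_of_laplacian_nonneg (z := fun y => κ * u y -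
    (-1 * Real.log (normSq y) - 2 * Real.log (Real.log (normSq y)) + C)) (c := 0) ?_ ?_ x
  · linarith
  · set q := κ * α / (2 * Real.pi) - 2 with hq
    have hq0 : 0 < q := by
      rw [hq, sub_pos, lt_div_iff₀ (by positivity)]
      linarith
    filter_upwards [eventually_le_norm 3, tendsto_log_one_add_norm.eventually_gt_atTop
      ((κ * B + 1 + q / 4 - 2 * Real.log (q / 8) - C + q) / (q / 2))] with y hy3 hy
    have hy0 : y ≠ 0 := by
      rintro rfl
      simp at hy3
      linarith
    have hA := one_le_log_normSq hy3
    have hbd := (log_normSq_bounds hy0).2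
    rw [div_lt_iff₀ (by positivity)] at hy
    have h1 := mul_le_mul_of_nonneg_left (abs_le.mp (hB y)).2 hκ.le
    have e1 : κ * (u y + α / (2 * Real.pi) * Real.log (1 + ‖y‖)) =
      κ * u y + (q + 2) * Real.log (1 + ‖y‖) := by rw [hq]; ring
    rw [e1] at h1
    -- The double logarithm is absorbed by half of the surplus slope `q`.
    have h2 := Real.log_le_sub_one_of_pos (by positivity : 0 < q / 8 * Real.log (normSq y))
    rw [Real.log_mul (by positivity) (by linarith)] at h2
    have h3 := mul_le_mul_of_nonneg_left hbd (by positivity : 0 ≤ q / 4)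
    nlinarith
  · intro y hy
    have hyR : R ≤ ‖y‖ := by
      by_contra! h
      have h1 := hC2 y h
      have h2 := mul_le_mul_of_nonneg_left (hM y) hκ.le
      linarith
    have hy3 : 3 ≤ ‖y‖ := (le_max_right _ _).trans hyR
    have hy0 : y ≠ 0 := by
      rintro rfl
      simp at hy3
      linarith
    have hΔ := hR₀ y ((le_max_left _ _).trans hyR) C
    have hexp := exp_barrier hy3 1 C
    have hsol := hu y
    rw [delta, if_neg hy0, mul_zero] at hsol
    have h1 : Real.exp (-1 * Real.log (normSq y) - 2 * Real.log (Real.log (normSq y)) + C) ≤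
        Real.exp (κ * u y) := by
      rw [Real.exp_le_exp]
      linarith
    have h2 : 450 / κ ≤ Real.exp C := by
      rw [← Real.log_le_iff_le_exp (by positivity)]
      exact hC1
    rw [hexp, sub_self, neg_zero, zero_mul, Real.exp_zero, mul_one] at h1
    have hA := one_le_log_normSq hy3
    have hs0 : 0 < normSq y := by nlinarith [norm_sq_le_normSq y]
    have h3 : 450 / (normSq y * Real.log (normSq y) ^ 2) ≤
        κ * (Real.exp C / (normSq y * Real.log (normSq y) ^ 2)) := by
      rw [← mul_div_assoc]
      gcongr
      rw [div_le_iff₀ hκ] at h2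
      linarith
    have h4 := mul_le_mul_of_nonneg_left h1 hκ.le
    rw [laplacian_sub, laplacian_const_mul]
    have h5 : κ * laplacian u y = κ * Real.exp (κ * u y) := by
      congr 1
      linarith
    linarith

/-- The barrier has the same logarithmic slope as the solution, so the double logarithm alone puts
it below at infinity. Inside the ball `b` controls the solution. The constants are uniform for
slopes up to `p₁`. -/
theorem lower_barrier_le_solution {κ : ℝ} (hκ : 0 < κ) (p₁ : ℝ)
    (b : ℤ × ℤ → ℝ) :
    ∃ R C : ℝ, ∀ (α β B : ℝ) (u : ℤ × ℤ → ℝ), 4 * Real.pi < α * κ →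
      α * κ / (4 * Real.pi) ≤ p₁ → IsSolution κ β u →
      (∀ x, |u x + α / (2 * Real.pi) * Real.log (1 + ‖x‖)| ≤ B) → (∀ x, b x ≤ u x) →
      ∀ x, R ≤ ‖x‖ →
        -(α * κ / (4 * Real.pi)) * Real.log (normSq x) -
          2 * Real.log (Real.log (normSq x)) + C ≤ κ * u x := by
  obtain ⟨R₀, hR₀⟩ := laplacian_lower_barrier p₁
  set R := max R₀ 3 with hR
  obtain ⟨C, hC1, hC2⟩ := exists_forall_norm_lt_le
    (fun x => -2 * Real.log (Real.log (normSq x)) - κ * b x + 1) R (Real.log (2 * κ))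
  refine ⟨R, -C, fun α β B u hα hp hu hB hb x _ => ?_⟩
  have hpi := Real.pi_pos
  set p := α * κ / (4 * Real.pi) with hpdef
  have hp1 : 1 < p := by rw [hpdef, lt_div_iff₀ (by positivity)]; linarith
  have key := lt_of_laplacian_nonneg (z := fun y =>
    (-p * Real.log (normSq y) - 2 * Real.log (Real.log (normSq y)) + -C) - κ * u y)
    (c := 0) ?_ ?_ x
  · linarith
  · have htend : Tendsto (fun y : ℤ × ℤ => Real.log (Real.log (normSq y))) cofinite atTop := by
      refine Real.tendsto_log_atTop.comp (tendsto_atTop_mono' _ ?_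
        (tendsto_atTop_add_const_right _ (-2)
          (tendsto_log_one_add_norm.const_mul_atTop (two_pos : (0 : ℝ) < 2))))
      filter_upwards [eventually_le_norm 3] with y hy3
      have hy0 : y ≠ 0 := by
        rintro rfl
        simp at hy3
        linarith
      linarith [(log_normSq_bounds hy0).1]
    filter_upwards [eventually_le_norm 3,
      htend.eventually_gt_atTop ((2 * p + κ * B - C) / 2)] with y hy3 hy
    have hy0 : y ≠ 0 := by
      rintro rfl
      simp at hy3
      linarith
    have hbd := (log_normSq_bounds hy0).1
    have h1 := mul_le_mul_of_nonneg_left (abs_le.mp (hB y)).1 hκ.le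
    have e1 : κ * (u y + α / (2 * Real.pi) * Real.log (1 + ‖y‖)) =
      κ * u y + 2 * p * Real.log (1 + ‖y‖) := by rw [hpdef]; field_simp; ring
    rw [e1] at h1
    have h3 := mul_le_mul_of_nonneg_left hbd (by positivity : 0 ≤ p)
    linarith
  · intro y hy
    have hyR : R ≤ ‖y‖ := by
      by_contra! h
      have h1 := hC2 y h
      have h2 := mul_le_mul_of_nonneg_left (hb y) hκ.le
      have h3 := mul_nonneg (by linarith : 0 ≤ p) (log_normSq_nonneg y)
      linarith
    have hy3 : 3 ≤ ‖y‖ := (le_max_right _ _).trans hyR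
    have hy0 : y ≠ 0 := by
      rintro rfl
      simp at hy3
      linarith
    have hΔ := hR₀ y ((le_max_left _ _).trans hyR) (-C) p (by linarith) hp
    have hexp := exp_barrier hy3 p (-C)
    have hsol := hu y
    rw [delta, if_neg hy0, mul_zero] at hsol
    have h1 : Real.exp (κ * u y) ≤
        Real.exp (-p * Real.log (normSq y) - 2 * Real.log (Real.log (normSq y)) + -C) := by
      rw [Real.exp_le_exp]
      linarith
    have h2 : κ * Real.exp (-C) ≤ 1 / 2 := by
      have := (Real.log_le_iff_le_exp (by positivity)).mp hC1
      rw [Real.exp_neg, ← div_eq_mul_inv, div_le_div_iff₀ (Real.exp_pos _) (by norm_num)]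
      linarith
    have hA := one_le_log_normSq hy3
    have hs0 : 0 < normSq y := by nlinarith [norm_sq_le_normSq y]
    have h6 : Real.exp (-(p - 1) * Real.log (normSq y)) ≤ 1 := by
      rw [Real.exp_le_one_iff]
      nlinarith
    have h3 : κ * (Real.exp (-C) * Real.exp (-(p - 1) * Real.log (normSq y)) /
        (normSq y * Real.log (normSq y) ^ 2)) ≤
        1 / (2 * (normSq y * Real.log (normSq y) ^ 2)) := by
      rw [← mul_div_assoc, ← mul_assoc, ← div_div 1 2]
      refine div_le_div_of_nonneg_right ?_ (by positivity)
      exact (mul_le_of_le_one_right (by positivity) h6).trans h2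
    rw [hexp] at h1
    have h4 := mul_le_mul_of_nonneg_left h1 hκ.le
    rw [laplacian_sub, laplacian_const_mul]
    have h5 : κ * laplacian u y = κ * Real.exp (κ * u y) := by
      congr 1
      linarith
    linarith

/-! ### The family of solutions and its critical limit -/

section Family

variable {κ α₀ β : ℝ} {v : ℝ → ℤ × ℤ → ℝ}

theorem le_log_of_hasSum_exp (hκ : 0 < κ) {m : ℝ} {u : ℤ × ℤ → ℝ}
    (h : HasSum (fun x => Real.exp (κ * u x)) m) (x : ℤ × ℤ) : u x ≤ 1 / κ * Real.log m := by
  have h1 := le_hasSum h x fun y _ => (Real.exp_pos _).le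
  have h2 := (Real.le_log_iff_exp_le ((Real.exp_pos _).trans_le h1)).mpr h1
  rw [one_div, inv_mul_eq_div, le_div_iff₀ hκ]
  linarith

/-- The differences of `e^{κu}` are nonnegative and sum to the difference of the parameters, so each
value is Lipschitz in `α`. -/
theorem tendsto_family (hκ : 0 < κ)
    (hsum : ∀ α ∈ Set.Ioo α₀ β, HasSum (fun x => Real.exp (κ * v α x)) (β - α))
    (hmono : ∀ α₁ ∈ Set.Ioo α₀ β, ∀ α₂ ∈ Set.Ioo α₀ β, α₁ < α₂ → ∀ x, v α₂ x < v α₁ x)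
    {α' : ℝ} (hα' : α' ∈ Set.Ioo α₀ β) (x : ℤ × ℤ) :
    Tendsto (fun α => v α x) (𝓝 α') (𝓝 (v α' x)) := by
  have key : ∀ α₁ ∈ Set.Ioo α₀ β, ∀ α₂ ∈ Set.Ioo α₀ β, α₁ < α₂ →
      |Real.exp (κ * v α₁ x) - Real.exp (κ * v α₂ x)| ≤ α₂ - α₁ := by
    intro α₁ h₁ α₂ h₂ h12
    have hle : ∀ y, 0 ≤ Real.exp (κ * v α₁ y) - Real.exp (κ * v α₂ y) := by
      intro y
      have := hmono α₁ h₁ α₂ h₂ h12 y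
      rw [sub_nonneg]
      gcongr
    have := le_hasSum ((hsum α₁ h₁).sub (hsum α₂ h₂)) x fun y _ => hle y
    rw [abs_of_nonneg (hle x)]
    linarith
  have hexp : Tendsto (fun α => Real.exp (κ * v α x)) (𝓝 α') (𝓝 (Real.exp (κ * v α' x))) := by
    rw [tendsto_iff_norm_sub_tendsto_zero]
    have h0 : Tendsto (fun α => |α - α'|) (𝓝 α') (𝓝 0) := by
      have : Tendsto (fun α => |α - α'|) (𝓝 α') (𝓝 |α' - α'|) :=
        Continuous.tendsto (by fun_prop) α'
      simpa using this
    refine squeeze_zero' (Eventually.of_forall fun α => norm_nonneg _) ?_ h0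
    filter_upwards [Ioo_mem_nhds hα'.1 hα'.2] with α hα
    rw [Real.norm_eq_abs]
    rcases lt_trichotomy α α' with h | rfl | h
    · rw [abs_of_neg (by linarith : α - α' < 0)]
      linarith [key α hα α' hα' h]
    · simp
    · rw [abs_of_pos (by linarith : 0 < α - α'), abs_sub_comm]
      exact key α' hα' α hα h
  have hlog := (hexp.log (Real.exp_pos _).ne').const_mul (1 / κ)
  simp only [Real.log_exp] at hlog
  refine (hlog.congr fun α => ?_).trans_eq ?_ <;> field_simp

theorem isSolution_of_tendsto {l : Filter ℝ} [l.NeBot] {u : ℤ × ℤ → ℝ}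
    (hlim : ∀ x, Tendsto (fun α => v α x) l (𝓝 (u x))) (hsol : ∀ᶠ α in l, IsSolution κ β (v α)) :
    IsSolution κ β u := by
  intro x
  have h1 : Tendsto (fun α => -laplacian (v α) x + Real.exp (κ * v α x)) l
      (𝓝 (-laplacian u x + Real.exp (κ * u x))) := by
    simp only [laplacian_eq]
    exact (((((hlim _).add (hlim _)).add (hlim _)).add (hlim _)).sub
      ((hlim x).const_mul 4)).neg.add (((hlim x).const_mul κ).rexp)
  refine tendsto_nhds_unique h1 (tendsto_const_nhds.congr' ?_)
  filter_upwards [hsol] with α hα using (hα x).symm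

/-- Finite partial sums pass to the limit and give one inequality; monotonicity in `α` prevents loss
of mass and gives the other. -/
theorem hasSum_exp_critical (hκ : 0 < κ) (hβ : α₀ < β) {u : ℤ × ℤ → ℝ}
    (hlim : ∀ x, Tendsto (fun α => v α x) (𝓝[>] α₀) (𝓝 (u x)))
    (hsum : ∀ α ∈ Set.Ioo α₀ β, HasSum (fun x => Real.exp (κ * v α x)) (β - α))
    (hle : ∀ α ∈ Set.Ioo α₀ β, ∀ x, v α x ≤ u x) :
    HasSum (fun x => Real.exp (κ * u x)) (β - α₀) := by
  have hpart : ∀ S : Finset (ℤ × ℤ), ∑ x ∈ S, Real.exp (κ * u x) ≤ β - α₀ := by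
    intro S
    have h1 : Tendsto (fun α => ∑ x ∈ S, Real.exp (κ * v α x)) (𝓝[>] α₀)
        (𝓝 (∑ x ∈ S, Real.exp (κ * u x))) :=
      tendsto_finsetSum _ fun x _ => ((hlim x).const_mul κ).rexp
    refine le_of_tendsto h1 ?_
    filter_upwards [Ioo_mem_nhdsGT hβ] with α hα
    refine (sum_le_hasSum S (fun y _ => (Real.exp_pos _).le) (hsum α hα)).trans ?_
    linarith [hα.1]
  have hs : Summable fun x => Real.exp (κ * u x) :=
    summable_of_sum_le (fun x => (Real.exp_pos _).le) hpart
  have hupper := hs.tsum_le_of_sum_le hpart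
  have hlower : β - α₀ ≤ ∑' x, Real.exp (κ * u x) := by
    have h1 : Tendsto (fun α : ℝ => β - α) (𝓝[>] α₀) (𝓝 (β - α₀)) :=
      (Continuous.tendsto (by fun_prop) α₀).mono_left nhdsWithin_le_nhds
    refine le_of_tendsto h1 ?_
    filter_upwards [Ioo_mem_nhdsGT hβ] with α hα
    refine hasSum_le (fun x => ?_) (hsum α hα) hs.hasSum
    have := hle α hα x
    gcongr
  rw [le_antisymm hlower hupper]
  exact hs.hasSum

theorem isBigO_critical (hκ : 0 < κ) (hα₀ : α₀ = 4 * Real.pi / κ) (hβ : α₀ < β)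
    {u : ℤ × ℤ → ℝ} (hlim : ∀ x, Tendsto (fun α => v α x) (𝓝[>] α₀) (𝓝 (u x)))
    (hsol : ∀ α ∈ Set.Ioo α₀ β, IsSolution κ β (v α))
    (hsum : ∀ α ∈ Set.Ioo α₀ β, HasSum (fun x => Real.exp (κ * v α x)) (β - α))
    (hB : ∀ α ∈ Set.Ioo α₀ β, ∃ B, ∀ x,
      |v α x + α / (2 * Real.pi) * Real.log (1 + ‖x‖)| ≤ B)
    (hmono : ∀ α₁ ∈ Set.Ioo α₀ β, ∀ α₂ ∈ Set.Ioo α₀ β, α₁ < α₂ → ∀ x, v α₂ x < v α₁ x) :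
    (fun x : ℤ × ℤ => u x - (-(2 / κ) * Real.log (len x) -
      2 / κ * Real.log (Real.log (len x)))) =O[cofinite] fun _ => (1 : ℝ) := by
  have hpi := Real.pi_pos
  have hcrit : ∀ α ∈ Set.Ioo α₀ β, 4 * Real.pi < α * κ := by
    intro α hα
    have := hα.1
    rwa [hα₀, div_lt_iff₀ hκ] at this
  -- A fixed intermediate member of the family bounds those with smaller parameter from below on the
  -- finite ball.
  obtain ⟨α₁, hα₁⟩ := exists_between hβ
  obtain ⟨R₁, C₁, hupper⟩ := solution_le_upper_barrier hκ (1 / κ * Real.log (β - α₀))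
  obtain ⟨R₂, C₂, hlower⟩ := lower_barrier_le_solution hκ (α₁ * κ / (4 * Real.pi)) (v α₁)
  have hup : ∀ x, R₁ ≤ ‖x‖ →
      κ * u x ≤ -1 * Real.log (normSq x) - 2 * Real.log (Real.log (normSq x)) + C₁ := by
    intro x hx
    refine le_of_tendsto ((hlim x).const_mul κ) ?_
    filter_upwards [Ioo_mem_nhdsGT hβ] with α hα
    obtain ⟨B, hBα⟩ := hB α hα
    refine hupper α β B (v α) (hcrit α hα) (hsol α hα) hBα (fun y => ?_) x hx
    refine (le_log_of_hasSum_exp hκ (hsum α hα) y).trans ?_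
    have := hα.2
    gcongr
    exact hα.1.le
  have hlow : ∀ x, R₂ ≤ ‖x‖ →
      -1 * Real.log (normSq x) - 2 * Real.log (Real.log (normSq x)) + C₂ ≤ κ * u x := by
    intro x hx
    have hleft : Tendsto (fun α : ℝ => -(α * κ / (4 * Real.pi)) * Real.log (normSq x) -
        2 * Real.log (Real.log (normSq x)) + C₂) (𝓝[>] α₀)
        (𝓝 (-(α₀ * κ / (4 * Real.pi)) * Real.log (normSq x) -
        2 * Real.log (Real.log (normSq x)) + C₂)) :=
      (Continuous.tendsto (by fun_prop) α₀).mono_left nhdsWithin_le_nhds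
    have hone : α₀ * κ / (4 * Real.pi) = 1 := by rw [hα₀]; field_simp
    rw [hone] at hleft
    refine le_of_tendsto_of_tendsto hleft ((hlim x).const_mul κ) ?_
    filter_upwards [Ioo_mem_nhdsGT hα₁.1] with α hα
    have hα' : α ∈ Set.Ioo α₀ β := ⟨hα.1, hα.2.trans hα₁.2⟩
    obtain ⟨B, hBα⟩ := hB α hα'
    refine hlower α β B (v α) (hcrit α hα') ?_ (hsol α hα') hBα
      (fun y => (hmono α hα' α₁ hα₁ hα.2 y).le) x hx
    have := hα.2
    gcongr
  refine IsBigO.of_bound (1 / κ * (|C₁| + |C₂| + 2 * Real.log 2)) ?_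
  filter_upwards [eventually_le_norm R₁, eventually_le_norm R₂, eventually_le_norm 3]
    with x h1 h2 h3
  have hA := one_le_log_normSq h3
  have hl2 := Real.log_pos (one_lt_two : (1 : ℝ) < 2)
  -- Passing from `ln ln|x|²` to `ln ln|x|` costs only the constant `ln 2`.
  have e : u x - (-(2 / κ) * Real.log (len x) - 2 / κ * Real.log (Real.log (len x))) =
      1 / κ * (κ * u x + Real.log (normSq x) + 2 * Real.log (Real.log (normSq x)) -
        2 * Real.log 2) := by
    rw [log_len, Real.log_div (by linarith) two_ne_zero]
    field_simp
    ring
  rw [e, norm_mul, Real.norm_of_nonneg (by positivity : 0 ≤ 1 / κ), norm_one, mul_one]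
  refine mul_le_mul_of_nonneg_left ?_ (by positivity)
  rw [Real.norm_eq_abs, abs_le]
  have hu1 := hup x h1
  have hl1 := hlow x h2
  constructor <;> linarith [le_abs_self C₁, neg_abs_le C₂, abs_nonneg C₁, abs_nonneg C₂]

end Family

end LatticeLiouville

/-! ### Assembling the family and its critical member -/

theorem theorem2 (κ β α₀ : ℝ) (hκ : 0 < κ) (hα₀ : α₀ = 4 * Real.pi / κ) (hβ : α₀ < β) :
    ∃ u : ℝ → ℤ × ℤ → ℝ,
      -- (i)
      (∀ α ∈ Set.Ioo α₀ β,
        LatticeLiouville.IsSolution κ β (u α) ∧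
        ∃ d : ℝ,
          (fun x : ℤ × ℤ =>
              u α x - (-(α / (2 * Real.pi)) * Real.log (LatticeLiouville.len x) + d))
            =O[cofinite] (fun x : ℤ × ℤ =>
              LatticeLiouville.len x ^
                  ((4 * Real.pi - α * κ) / (α * κ + 2 * Real.pi)) *
                Real.log (LatticeLiouville.len x) ^
                  (2 * Real.pi / (α * κ + 2 * Real.pi))) ∧
          d ≤ 1 / κ * Real.log (β - α) - LatticeLiouville.gammaZero / 2 * α) ∧
      -- (ii)
      (LatticeLiouville.IsSolution κ β (u α₀) ∧
        (fun x : ℤ × ℤ =>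
            u α₀ x - (-(2 / κ) * Real.log (LatticeLiouville.len x)
              - 2 / κ * Real.log (Real.log (LatticeLiouville.len x))))
          =O[cofinite] (fun _ => (1 : ℝ))) ∧
      -- (iii)
      (∀ α₁ α₂ : ℝ, α₀ ≤ α₁ → α₁ < α₂ → α₂ < β → ∀ x, u α₂ x < u α₁ x) ∧
      (∀ α' ∈ Set.Ioo α₀ β, ∀ x, Tendsto (fun α => u α x) (𝓝 α') (𝓝 (u α' x))) ∧
      (∀ x, Tendsto (fun α => u α x) (𝓝[>] α₀) (𝓝 (u α₀ x))) ∧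
      (∀ α ∈ Set.Ico α₀ β, HasSum (fun x => Real.exp (κ * u α x)) (β - α)) := by
  have hcrit : ∀ α ∈ Set.Ioo α₀ β, 4 * Real.pi < α * κ := by
    intro α hα
    have := hα.1
    rwa [hα₀, div_lt_iff₀ hκ] at this
  choose! v hsol hsum hB hexp using fun α (hα : α ∈ Set.Ioo α₀ β) =>
    LatticeLiouville.exists_solution hκ (hcrit α hα) hα.2
  have hmono : ∀ α₁ ∈ Set.Ioo α₀ β, ∀ α₂ ∈ Set.Ioo α₀ β, α₁ < α₂ → ∀ x, v α₂ x < v α₁ x := by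
    intro α₁ h₁ α₂ h₂ h12
    obtain ⟨B₁, hB₁⟩ := hB α₁ h₁
    obtain ⟨B₂, hB₂⟩ := hB α₂ h₂
    exact LatticeLiouville.solution_lt_solution hκ h12 (hsol α₁ h₁) (hsol α₂ h₂) hB₁ hB₂
  have hanti : ∀ x, AntitoneOn (fun α => v α x) (Set.Ioo α₀ β) := by
    intro x α₁ h₁ α₂ h₂ h12
    rcases h12.eq_or_lt with rfl | h
    · exact le_rfl
    · exact (hmono α₁ h₁ α₂ h₂ h x).le
  have hbdd : ∀ x, BddAbove ((fun α => v α x) '' Set.Ioo α₀ β) := by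
    rintro x
    refine ⟨1 / κ * Real.log (β - α₀), ?_⟩
    rintro _ ⟨α, hα, rfl⟩
    refine (LatticeLiouville.le_log_of_hasSum_exp hκ (hsum α hα) x).trans ?_
    have := hα.2
    gcongr
    exact hα.1.le
  -- Monotonicity in `α` makes this supremum the limit from the right at `α₀`.
  set u₀ : ℤ × ℤ → ℝ := fun x => sSup ((fun α => v α x) '' Set.Ioo α₀ β) with hu₀
  have hlim : ∀ x, Tendsto (fun α => v α x) (𝓝[>] α₀) (𝓝 (u₀ x)) := fun x =>
    (hanti x).tendsto_nhdsWithin_Ioo_right (Set.nonempty_Ioo.mpr hβ) (hbdd x)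
  have hle : ∀ α ∈ Set.Ioo α₀ β, ∀ x, v α x ≤ u₀ x := fun α hα x =>
    le_csSup (hbdd x) ⟨α, hα, rfl⟩
  have hevent : ∀ᶠ α in 𝓝[>] α₀, α ∈ Set.Ioo α₀ β := Ioo_mem_nhdsGT hβ
  -- Outside `[α₀, β)` the values are whatever `choose!` supplies; no claim concerns them.
  set u : ℝ → ℤ × ℤ → ℝ := fun α => if α = α₀ then u₀ else v α with hu
  have hcritical : u α₀ = u₀ := if_pos rfl
  have hother : ∀ α, α₀ < α → u α = v α := fun α hα => if_neg hα.ne'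
  refine ⟨u, fun α hα => ?_, ⟨?_, ?_⟩, fun α₁ α₂ h1 h12 h2 x => ?_, fun α' hα' x => ?_,
    fun x => ?_, fun α hα => ?_⟩
  · rw [hother α hα.1]
    obtain ⟨d, C, hd, hC⟩ := hexp α hα
    exact ⟨hsol α hα, d, LatticeLiouville.isBigO_remainder (hcrit α hα) hC, hd⟩
  · rw [hcritical]
    exact LatticeLiouville.isSolution_of_tendsto hlim (hevent.mono hsol)
  · rw [hcritical]
    exact LatticeLiouville.isBigO_critical hκ hα₀ hβ hlim hsol hsum hB hmono
  · rw [hother α₂ (h1.trans_lt h12)]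
    rcases h1.eq_or_lt with rfl | h
    -- The limit preserves only weak inequalities; an intermediate parameter restores strictness.
    · obtain ⟨α, hα⟩ := exists_between h12
      rw [hcritical]
      exact (hmono α ⟨hα.1, hα.2.trans h2⟩ α₂ ⟨h12, h2⟩ hα.2 x).trans_le
        (hle α ⟨hα.1, hα.2.trans h2⟩ x)
    · rw [hother α₁ h]
      exact hmono α₁ ⟨h, h12.trans h2⟩ α₂ ⟨h.trans h12, h2⟩ h12 x
  · rw [hother α' hα'.1]
    refine (LatticeLiouville.tendsto_family hκ hsum hmono hα' x).congr' ?_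
    filter_upwards [Ioo_mem_nhds hα'.1 hα'.2] with α hα
    rw [hother α hα.1]
  · rw [hcritical]
    refine (hlim x).congr' ?_
    filter_upwards [self_mem_nhdsWithin] with α hα
    rw [hother α hα]
  · rcases hα.1.eq_or_lt with rfl | h
    · rw [hcritical]
      exact LatticeLiouville.hasSum_exp_critical hκ hβ hlim hsum hle
    · rw [hother α h]
      exact hsum α ⟨h, hα.2⟩
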